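/- On $L^2(\mathbb R)$ let $\Pi$ be the closure (in the graph norm) of the symmetric operator $(\Pi\psi)(x)=i\,[x\psi(x)+x^2\psi'(x)]$, $\psi\in\mathcal S(\mathbb R)$, and let $D_0$ be its domain. For $\theta\in\mathbb R$ put $\zeta_\theta(x)=\frac1x e^{-1/|x|}e^{i\,\mathrm{sgn}(x)\theta/2}$ and let $\Pi_\theta$ be the self-adjoint extension of $\Pi$ with domain $D_0+\mathbb C\,\zeta_\theta$ and action $\Pi_\theta(\psi+c\,\zeta_\theta)=\Pi\psi+c\,\zeta_{\theta+\pi}$. Let $P^\theta_\epsilon$ be the spectral projection $\chi_{[0,\epsilon]}(\Pi_\theta)$ if $\epsilon>0$ and $\chi_{[\epsilon,0]}(\Pi_\theta)$ if $\epsilon\le 0$, and let $Q_\Lambda$ be multiplication by the indicator function of $\Lambda$. **Lemma.** Let $\Lambda=[a,b]$ with $a<b$ and $ab>0$, let $\theta\in\mathbb R$ and $\epsilon\in\mathbb R$. Then $P^\theta_\epsilon Q_\Lambda$ is trace class, and the local integrated density of states $$\mathcal N^\theta_\Lambda(\epsilon):=\frac{\mathrm{sgn}(\epsilon)}{|\Lambda|}\,\mathrm{Tr}\big(P^\theta_\epsilon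 Q_\Lambda\big)$$ satisfies $$\mathcal N^\theta_\Lambda(\epsilon)=\frac{1}{ab}\,\frac{\epsilon}{2\pi},$$ independently of $\theta$. -/

import Mathlib

open MeasureTheory SchwartzMap
open scoped ENNReal InnerProductSpace

noncomputable section

namespace ThermalDOS

/-! ### Projection-valued measures and spectral projections of an unbounded operator -/

section Spectral

variable {H : Type*} [NormedAddCommGroup H] [InnerProductSpace ℂ H] [CompleteSpace H]

/-- A projection-valued measure on the Borel sets of `ℝ`: orthogonal projections `E B`, with
`E ℝ = 1`, countably additive in the strong operator topology. (Values at non-measurable sets are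
irrelevant.) -/
structure ProjectionMeasure (H : Type*) [NormedAddCommGroup H] [InnerProductSpace ℂ H]
    [CompleteSpace H] where
  proj : Set ℝ → H →L[ℂ] H
  isStarProjection : ∀ B, MeasurableSet B → IsStarProjection (proj B)
  univ : proj Set.univ = 1
  hasSum_iUnion : ∀ B : ℕ → Set ℝ, (∀ i, MeasurableSet (B i)) →
    Pairwise (Function.onFun Disjoint B) →
    ∀ ψ : H, HasSum (fun i => proj (B i) ψ) (proj (⋃ i, B i) ψ)

namespace ProjectionMeasure

lemma re_inner_proj (E : ProjectionMeasure H) {B : Set ℝ} (hB : MeasurableSet B) (ψ : H) :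
    (⟪ψ, E.proj B ψ⟫_ℂ).re = ‖E.proj B ψ‖ ^ 2 := by
  have h := E.isStarProjection B hB
  have h1 : E.proj B ψ = E.proj B (E.proj B ψ) := by
    conv_lhs => rw [← h.isIdempotentElem.eq]
    rfl
  have h2 : ContinuousLinearMap.adjoint (E.proj B) = E.proj B := h.isSelfAdjoint
  have h3 : ⟪ψ, E.proj B ψ⟫_ℂ = ⟪E.proj B ψ, E.proj B ψ⟫_ℂ := by
    rw [h1, ← ContinuousLinearMap.adjoint_inner_left, h2, ← h1]
  rw [h3, inner_self_eq_norm_sq_to_K]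
  norm_cast

lemma hasSum_norm_sq (E : ProjectionMeasure H) (B : ℕ → Set ℝ) (hB : ∀ i, MeasurableSet (B i))
    (hd : Pairwise (Function.onFun Disjoint B)) (ψ : H) :
    HasSum (fun i => ‖E.proj (B i) ψ‖ ^ 2) (‖E.proj (⋃ i, B i) ψ‖ ^ 2) := by
  have h := (E.hasSum_iUnion B hB hd ψ).mapL (Complex.reCLM.comp ((innerSL ℂ ψ).restrictScalars ℝ))
  have e : ∀ S, MeasurableSet S →
      (Complex.reCLM.comp ((innerSL ℂ ψ).restrictScalars ℝ)) (E.proj S ψ) = ‖E.proj S ψ‖ ^ 2 :=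
    fun S hS => E.re_inner_proj hS ψ
  rw [e _ (MeasurableSet.iUnion hB)] at h
  simpa only [e _ (hB _)] using h

lemma proj_empty (E : ProjectionMeasure H) : E.proj ∅ = 0 := by
  ext ψ
  have h := (E.hasSum_iUnion (fun _ => ∅) (fun _ => MeasurableSet.empty)
    (fun _ _ _ => by simp [Function.onFun]) ψ).summable
  exact (summable_const_iff _).1 h

/-- The scalar spectral measure `μ_ψ(B) = ‖E(B) ψ‖² = ⟨ψ, E(B) ψ⟩`. -/
def scalarMeasure (E : ProjectionMeasure H) (ψ : H) : Measure ℝ :=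
  Measure.ofMeasurable (fun B _ => ENNReal.ofReal (‖E.proj B ψ‖ ^ 2))
    (by simp [E.proj_empty])
    (by
      intro B hB hd
      have h := E.hasSum_norm_sq B hB hd ψ
      rw [← h.tsum_eq, ENNReal.ofReal_tsum_of_nonneg (fun _ => by positivity) h.summable])

lemma scalarMeasure_apply (E : ProjectionMeasure H) (ψ : H) {B : Set ℝ} (hB : MeasurableSet B) :
    E.scalarMeasure ψ B = ENNReal.ofReal (‖E.proj B ψ‖ ^ 2) :=
  Measure.ofMeasurable_apply B hB

/-- `E` is the spectral measure of the operator `A`, that is `A = ∫ l dE(l)`: the domain of `A` is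
`{ψ | ∫ l² dμ_ψ(l) < ∞}`, and `⟨ψ, A ψ⟩ = ∫ l dμ_ψ(l)` on it. -/
def Represents (E : ProjectionMeasure H) (A : H →ₗ.[ℂ] H) : Prop :=
  (∀ ψ : H, ψ ∈ A.domain ↔ Integrable (fun l : ℝ => l ^ 2) (E.scalarMeasure ψ)) ∧
  ∀ ψ : A.domain, ⟪(ψ : H), A ψ⟫_ℂ = ((∫ l : ℝ, l ∂(E.scalarMeasure (ψ : H)) : ℝ) : ℂ)

end ProjectionMeasure

open Classical in
/-- The spectral projection `χ_B(A)` of a self-adjoint operator `A`, given by its (unique) spectral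
measure; the value is `0` if `A` has no spectral measure, i.e. is not self-adjoint. -/
def spectralProjection (A : H →ₗ.[ℂ] H) (B : Set ℝ) : H →L[ℂ] H :=
  if h : ∃ E : ProjectionMeasure H, E.Represents A then h.choose.proj B else 0

end Spectral

/-! ### Trace class operators and the trace -/

section Trace

variable {H : Type*} [NormedAddCommGroup H] [InnerProductSpace ℂ H] [CompleteSpace H]

/-- `T` is trace class: `Tr |T| = ∑ ⟨e_i, |T| e_i⟩ < ∞` for the orthonormal bases `(e_i)` of `H`,
where `|T| = (T* T)^{1/2}`. -/
def IsTraceClass (T : H →L[ℂ] H) : Prop :=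
  ∀ (w : Set H) (e : HilbertBasis w ℂ H),
    Summable fun i => (⟪e i, CFC.sqrt (ContinuousLinearMap.adjoint T * T) (e i)⟫_ℂ).re

/-- The trace `∑ ⟨e_i, T e_i⟩`, computed in some orthonormal basis `(e_i)` of `H` (for trace class
`T` the sum converges absolutely and does not depend on the basis). -/
def trace (T : H →L[ℂ] H) : ℂ :=
  ∑' i, ⟪(exists_hilbertBasis ℂ H).choose_spec.choose i,
    T ((exists_hilbertBasis ℂ H).choose_spec.choose i)⟫_ℂ

end Trace

/-! ### The operators `Π_θ` on `L²(ℝ)` -/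

/-- The Hilbert space `L²(ℝ)`. -/
abbrev L2 : Type := Lp ℂ 2 (volume : Measure ℝ)

/-- `(Π ψ)(x) = i (x ψ(x) + x² ψ'(x))` on Schwartz functions. -/
def schwartzPi : 𝓢(ℝ, ℂ) →ₗ[ℂ] 𝓢(ℝ, ℂ) :=
  Complex.I • ((smulLeftCLM ℂ (fun x : ℝ => (x : ℂ))).toLinearMap +
    (smulLeftCLM ℂ (fun x : ℝ => (x : ℂ) ^ 2)).toLinearMap ∘ₗ (derivCLM ℂ ℂ).toLinearMap)

lemma schwartzPi_apply (ψ : 𝓢(ℝ, ℂ)) (x : ℝ) :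
    schwartzPi ψ x = Complex.I * ((x : ℂ) * ψ x + (x : ℂ) ^ 2 * deriv ψ x) := by
  have h1 : (fun x : ℝ => (x : ℂ)).HasTemperateGrowth := by fun_prop
  have h2 : (fun x : ℝ => (x : ℂ) ^ 2).HasTemperateGrowth := by fun_prop
  simp [schwartzPi, smulLeftCLM_apply_apply h1, smulLeftCLM_apply_apply h2, mul_add]

/-- The graph of `Π` on the Schwartz space, in `L²(ℝ) × L²(ℝ)`. -/
def schwartzPiGraph : Submodule ℂ (L2 × L2) :=
  LinearMap.range
    ((toLpCLM ℂ ℂ 2 (volume : Measure ℝ)).toLinearMap.prod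
      ((toLpCLM ℂ ℂ 2 (volume : Measure ℝ)).toLinearMap ∘ₗ schwartzPi))

/-- `ζ_θ(x) = x⁻¹ e^{-1/|x|} e^{i sgn(x) θ/2}`. -/
def zetaFun (θ x : ℝ) : ℂ :=
  ((x⁻¹ * Real.exp (-1 / |x|) : ℝ) : ℂ) * Complex.exp (Complex.I * (SignType.sign x : ℝ) * (θ / 2))

lemma measurable_zetaFun (θ : ℝ) : Measurable (zetaFun θ) := by
  have : Measurable fun x : ℝ => ((SignType.sign x : SignType) : ℝ) := by
    have h : (fun x : ℝ => ((SignType.sign x : SignType) : ℝ)) =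
        fun x : ℝ => if 0 < x then 1 else if x < 0 then -1 else 0 := by
      funext x
      rcases lt_trichotomy x 0 with h | h | h
      · simp [h, h.not_gt]
      · simp [h]
      · simp [h]
    rw [h]
    exact Measurable.ite measurableSet_Ioi measurable_const
      (Measurable.ite measurableSet_Iio measurable_const measurable_const)
  unfold zetaFun
  fun_prop

lemma norm_zetaFun_sq_le (θ x : ℝ) : ‖zetaFun θ x‖ ^ 2 ≤ (1 + x ^ 2)⁻¹ := by
  have h1 : ‖zetaFun θ x‖ = |x|⁻¹ * Real.exp (-1 / |x|) := by
    have : Complex.I * ((SignType.sign x : ℝ) : ℂ) * ((θ : ℂ) / 2) =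
        (((SignType.sign x : ℝ) * (θ / 2) : ℝ) : ℂ) * Complex.I := by
      push_cast; ring
    rw [zetaFun, norm_mul, this, Complex.norm_exp_ofReal_mul_I, mul_one, Complex.norm_real,
      norm_mul, norm_inv, Real.norm_eq_abs, Real.norm_of_nonneg (Real.exp_pos _).le]
  rw [h1]
  rcases eq_or_ne x 0 with rfl | hx
  · simp
  have hx' : 0 < |x| := abs_pos.2 hx
  obtain ⟨t, ht⟩ : ∃ t, t = |x|⁻¹ := ⟨_, rfl⟩
  have ht0 : 0 < t := ht ▸ inv_pos.2 hx'
  have hxt : x ^ 2 = (t ^ 2)⁻¹ := by rw [ht, inv_pow, inv_inv, sq_abs]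
  have he : Real.exp (-1 / |x|) = (Real.exp t)⁻¹ := by
    rw [← Real.exp_neg, ht]; congr 1; ring
  have hexp : 1 + t ≤ Real.exp t := by linarith [Real.add_one_le_exp t]
  have hsq : 1 + t ^ 2 ≤ Real.exp t ^ 2 := by nlinarith
  rw [← ht, he, hxt]
  have : (1 + (t ^ 2)⁻¹)⁻¹ = t ^ 2 * (1 + t ^ 2)⁻¹ := by field_simp; ring
  rw [this, mul_pow, inv_pow]
  gcongr

lemma memLp_zetaFun (θ : ℝ) : MemLp (zetaFun θ) 2 (volume : Measure ℝ) := by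
  rw [memLp_two_iff_integrable_sq_norm (measurable_zetaFun θ).aestronglyMeasurable]
  refine integrable_inv_one_add_sq.mono'
    ((measurable_zetaFun θ).norm.pow_const 2).aestronglyMeasurable (.of_forall fun x => ?_)
  rw [Real.norm_of_nonneg (by positivity)]
  exact norm_zetaFun_sq_le θ x

/-- `ζ_θ` as an element of `L²(ℝ)`. -/
def zeta (θ : ℝ) : L2 := (memLp_zetaFun θ).toLp (zetaFun θ)

/-- The self-adjoint extension `Π_θ`: its domain is `D₀ + ℂ ζ_θ`, with `D₀` the domain of the
closure of `Π` on the Schwartz space, and `Π_θ (ψ + c ζ_θ) = Π ψ + c ζ_{θ + π}`. -/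
def thermalPi (θ : ℝ) : L2 →ₗ.[ℂ] L2 :=
  (schwartzPiGraph.topologicalClosure ⊔
    Submodule.span ℂ {(zeta θ, zeta (θ + Real.pi))}).toLinearPMap

/-! ### The local integrated density of states -/

/-- `Q_Λ ψ = χ_Λ ψ` on `L²(ℝ)`, for measurable `Λ`. -/
def restrictionProj (Λ : Set ℝ) (hΛ : MeasurableSet Λ) : L2 →L[ℂ] L2 :=
  LinearMap.mkContinuous
    { toFun := fun ψ => ((Lp.memLp ψ).indicator hΛ).toLp (Λ.indicator ψ)
      map_add' := fun ψ φ => by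
        rw [← MemLp.toLp_add]
        refine MemLp.toLp_congr _ _ ?_
        filter_upwards [Lp.coeFn_add ψ φ] with x hx
        by_cases h : x ∈ Λ
        · simpa [h] using hx
        · simp [h]
      map_smul' := fun c ψ => by
        rw [RingHom.id_apply, ← MemLp.toLp_const_smul]
        refine MemLp.toLp_congr _ _ ?_
        filter_upwards [Lp.coeFn_smul c ψ] with x hx
        by_cases h : x ∈ Λ
        · simpa [h] using hx
        · simp [h] }
    1
    (fun ψ => by
      rw [one_mul]
      refine Lp.norm_le_norm_of_ae_le ?_
      filter_upwards [((Lp.memLp ψ).indicator hΛ).coeFn_toLp] with x hx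
      refine (congrArg norm hx).trans_le ?_
      exact norm_indicator_le_norm_self _ _)

/-- The spectral projection `P^θ_ε`: `χ_{[0,ε]}(Π_θ)` if `ε > 0` and `χ_{[ε,0]}(Π_θ)` if `ε < 0`
(extended to `ε = 0` by `χ_{{0}}(Π_θ)`). -/
def thermalProj (θ ε : ℝ) : L2 →L[ℂ] L2 :=
  spectralProjection (thermalPi θ) (if 0 < ε then Set.Icc 0 ε else Set.Icc ε 0)

/-- The local integrated density of states `sgn(ε) |Λ|⁻¹ Tr (P^θ_ε Q_Λ)` for `Λ = [a, b]`. -/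
def localIDOS (θ a b ε : ℝ) : ℂ :=
  ((SignType.sign ε : ℝ) : ℂ) / ((volume (Set.Icc a b)).toReal : ℂ) *
    trace (thermalProj θ ε ∘L restrictionProj (Set.Icc a b) measurableSet_Icc)

end ThermalDOS

end

/-! The substitution u = 1/x straightens Π. The unitary `kelvin θ`, f ↦ u⁻¹ e^{-i sgn(u) θ/2}
f(1/u), turns Π into -i d/du acting on functions that vanish at u = 0. It sends ζ_θ to e^{-|u|} and
ζ_{θ+π} to i sgn(u) e^{-|u|}, which is -i d/du of the former off 0. Adjoining ζ_θ therefore replaces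
vanishing at 0 by continuity across 0, and Π_θ becomes -i d/du on the whole line. The Fourier
transform then makes it multiplication by 2πξ, and θ survives only in the unitary.

Between two unitaries, P Q_Λ is 1_I 𝓕 1_J. Here I is an interval of length |ε|/(2π), and J = {1/x :
x ∈ Λ} is an interval of length 1/a - 1/b, bounded because ab > 0. The kernel e^{-2πiuξ} on I × J
expands in its power series into rank-one kernels with summable norms. This gives the trace class
property, and the trace is the integral over I × J of the kernel times its conjugate, that is
|I||J|. Division by b - a leaves |ε|/(2πab).

Three groups of results carry this. `mem_thermalGraph_iff` identifies Π_θ with the multiplication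
operator: one inclusion is integration by parts, the other follows from surjectivity of Π_θ + i.
`Represents.proj_eq` is uniqueness of the spectral measure, needed because `spectralProjection`
selects some representing measure. `isTraceClass_of_nuclear` and `trace_eq_of_nuclear`, fed by
`hasSum_cutoff` and `tsum_inner_truncMonomial`, give the trace. -/

noncomputable section

namespace ThermalDOS

/-! ### Uniqueness of the spectral measure of an unbounded operator. -/

section Uniqueness

variable {H : Type*} [NormedAddCommGroup H] [InnerProductSpace ℂ H] [CompleteSpace H]

namespace ProjectionMeasure

open Filter Topology

lemma proj_union (E : ProjectionMeasure H) {B C : Set ℝ} (hB : MeasurableSet B)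
    (hC : MeasurableSet C) (hd : Disjoint B C) (ψ : H) :
    E.proj (B ∪ C) ψ = E.proj B ψ + E.proj C ψ := by
  let S : ℕ → Set ℝ := fun i => if i = 0 then B else if i = 1 then C else ∅
  have hS : ∀ i, MeasurableSet (S i) := fun i => by
    dsimp only [S]; split_ifs <;> simp [hB, hC]
  have hp : Pairwise (Function.onFun Disjoint S) := fun i j hij => by
    dsimp only [S, Function.onFun]; split_ifs <;> first | omega | simp [hd.symm]
  have hU : ⋃ i, S i = B ∪ C := by
    apply Set.Subset.antisymm
    · refine Set.iUnion_subset fun i => ?_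
      dsimp only [S]; split_ifs <;> simp
    · refine Set.union_subset ?_ ?_
      · exact (show B = S 0 by simp [S]) ▸ Set.subset_iUnion S 0
      · exact (show C = S 1 by simp [S]) ▸ Set.subset_iUnion S 1
  have h1 := E.hasSum_iUnion S hS hp ψ
  have h2 : HasSum (fun i => E.proj (S i) ψ) (∑ i ∈ {0, 1}, E.proj (S i) ψ) :=
    hasSum_sum_of_ne_finset_zero fun i hi => by
      simp only [Finset.mem_insert, Finset.mem_singleton, not_or] at hi
      simp [S, hi.1, hi.2, E.proj_empty]
  rw [← hU, h1.unique h2]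
  simp [S]

lemma proj_proj_self (E : ProjectionMeasure H) {B : Set ℝ} (hB : MeasurableSet B) (ψ : H) :
    E.proj B (E.proj B ψ) = E.proj B ψ :=
  congrArg (fun T : H →L[ℂ] H => T ψ) (E.isStarProjection B hB).isIdempotentElem.eq

lemma inner_proj_left (E : ProjectionMeasure H) {B : Set ℝ} (hB : MeasurableSet B) (ψ φ : H) :
    ⟪E.proj B ψ, φ⟫_ℂ = ⟪ψ, E.proj B φ⟫_ℂ := by
  have h2 : ContinuousLinearMap.adjoint (E.proj B) = E.proj B :=
    (E.isStarProjection B hB).isSelfAdjoint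
  conv_lhs => rw [← h2]
  exact ContinuousLinearMap.adjoint_inner_left _ _ _

lemma norm_proj_le (E : ProjectionMeasure H) {B : Set ℝ} (hB : MeasurableSet B) (ψ : H) :
    ‖E.proj B ψ‖ ≤ ‖ψ‖ := by
  have := (E.proj B).le_of_opNorm_le (IsStarProjection.norm_le _ (E.isStarProjection B hB)) ψ
  simpa using this

lemma norm_sq_proj_union (E : ProjectionMeasure H) {B C : Set ℝ} (hB : MeasurableSet B)
    (hC : MeasurableSet C) (hd : Disjoint B C) (ψ : H) :
    ‖E.proj (B ∪ C) ψ‖ ^ 2 = ‖E.proj B ψ‖ ^ 2 + ‖E.proj C ψ‖ ^ 2 := by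
  rw [← E.re_inner_proj (hB.union hC), E.proj_union hB hC hd, inner_add_right, Complex.add_re,
    E.re_inner_proj hB, E.re_inner_proj hC]

/-- Pythagoras: a vector in the range of `E.proj B` already has its full norm there, and `E.proj (B
∪ C)` is a contraction, so nothing is left for the `C` component. -/
lemma proj_proj_disjoint (E : ProjectionMeasure H) {B C : Set ℝ} (hB : MeasurableSet B)
    (hC : MeasurableSet C) (hd : Disjoint B C) (ψ : H) : E.proj C (E.proj B ψ) = 0 := by
  have h1 := E.norm_sq_proj_union hB hC hd (E.proj B ψ)
  have h2 := E.norm_proj_le (hB.union hC) (E.proj B ψ)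
  rw [E.proj_proj_self hB] at h1
  have h3 : ‖E.proj C (E.proj B ψ)‖ ^ 2 ≤ 0 := by
    nlinarith [norm_nonneg (E.proj (B ∪ C) (E.proj B ψ)), norm_nonneg (E.proj B ψ)]
  have h4 : ‖E.proj C (E.proj B ψ)‖ = 0 := by
    nlinarith [norm_nonneg (E.proj C (E.proj B ψ))]
  exact norm_eq_zero.1 h4

lemma proj_proj (E : ProjectionMeasure H) {B C : Set ℝ} (hB : MeasurableSet B)
    (hC : MeasurableSet C) (ψ : H) : E.proj B (E.proj C ψ) = E.proj (B ∩ C) ψ := by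
  have h1 : E.proj C ψ = E.proj (B ∩ C) ψ + E.proj (C \ B) ψ := by
    rw [← E.proj_union (hB.inter hC) (hC.diff hB)
      (Set.disjoint_left.2 fun x hx hx' => hx'.2 hx.1), Set.inter_comm, Set.inter_union_sdiff]
  have h2 : E.proj B (E.proj (B ∩ C) ψ) = E.proj (B ∩ C) ψ := by
    have h3 := E.proj_union (hB.inter hC) (hB.diff hC)
      (Set.disjoint_left.2 fun x hx hx' => hx'.2 hx.2) (E.proj (B ∩ C) ψ)
    rw [Set.inter_union_sdiff] at h3
    rw [h3, E.proj_proj_self (hB.inter hC), E.proj_proj_disjoint (hB.inter hC) (hB.diff hC)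
      (Set.disjoint_left.2 fun x hx hx' => hx'.2 hx.2), add_zero]
  rw [h1, map_add, h2, E.proj_proj_disjoint (hC.diff hB) hB Set.disjoint_sdiff_left, add_zero]

lemma proj_add_proj_compl (E : ProjectionMeasure H) {B : Set ℝ} (hB : MeasurableSet B) (ψ : H) :
    E.proj B ψ + E.proj Bᶜ ψ = ψ := by
  rw [← E.proj_union hB hB.compl disjoint_compl_right, Set.union_compl_self, E.univ]
  rfl

lemma inner_eq_zero_of_compl (E : ProjectionMeasure H) {B : Set ℝ} (hB : MeasurableSet B)
    {x y : H} (hx : E.proj B x = x) (hy : E.proj Bᶜ y = y) : ⟪x, y⟫_ℂ = 0 := by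
  rw [← hx, ← hy, E.inner_proj_left hB, E.proj_proj hB hB.compl]
  simp [E.proj_empty]

instance (E : ProjectionMeasure H) (ψ : H) : IsFiniteMeasure (E.scalarMeasure ψ) :=
  ⟨by rw [E.scalarMeasure_apply ψ MeasurableSet.univ]; exact ENNReal.ofReal_lt_top⟩

lemma scalarMeasure_univ_toReal (E : ProjectionMeasure H) (ψ : H) :
    (E.scalarMeasure ψ).real Set.univ = ‖ψ‖ ^ 2 := by
  rw [measureReal_def, E.scalarMeasure_apply ψ MeasurableSet.univ,
    ENNReal.toReal_ofReal (by positivity), E.univ]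
  rfl

lemma scalarMeasure_proj (E : ProjectionMeasure H) {B : Set ℝ} (hB : MeasurableSet B) (ψ : H) :
    E.scalarMeasure (E.proj B ψ) = (E.scalarMeasure ψ).restrict B := by
  ext C hC
  rw [Measure.restrict_apply hC, E.scalarMeasure_apply _ hC,
    E.scalarMeasure_apply _ (hC.inter hB), E.proj_proj hC hB]

/-- Vectors in complementary spectral subspaces keep orthogonal images under every `E.proj C`, so no
cross terms appear. -/
lemma scalarMeasure_add (E : ProjectionMeasure H) {B : Set ℝ} (hB : MeasurableSet B)
    {x y : H} (hx : E.proj B x = x) (hy : E.proj Bᶜ y = y) :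
    E.scalarMeasure (x + y) = E.scalarMeasure x + E.scalarMeasure y := by
  ext C hC
  rw [Measure.add_apply, E.scalarMeasure_apply _ hC, E.scalarMeasure_apply _ hC,
    E.scalarMeasure_apply _ hC, ← ENNReal.ofReal_add (by positivity) (by positivity), map_add]
  congr 1
  have h : ⟪E.proj C x, E.proj C y⟫_ℂ = 0 := by
    refine E.inner_eq_zero_of_compl hB ?_ ?_
    · rw [E.proj_proj hB hC, Set.inter_comm, ← E.proj_proj hC hB, hx]
    · rw [E.proj_proj hB.compl hC, Set.inter_comm, ← E.proj_proj hC hB.compl, hy]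
  have := norm_add_sq_eq_norm_sq_add_norm_sq_of_inner_eq_zero (𝕜 := ℂ) _ _ h
  nlinarith [this]

lemma integrable_id_of_sq {μ : Measure ℝ} [IsFiniteMeasure μ]
    (h : Integrable (fun l : ℝ => l ^ 2) μ) : Integrable (fun l : ℝ => l) μ := by
  refine ((integrable_const (1 : ℝ)).add h).mono' measurable_id.aestronglyMeasurable
    (.of_forall fun l => ?_)
  simp only [Pi.add_apply, Real.norm_eq_abs]
  nlinarith [sq_abs l, sq_nonneg (|l| - 1)]

section Represents

variable {E : ProjectionMeasure H} {A : H →ₗ.[ℂ] H}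

lemma Represents.integrable_sq (h : E.Represents A) {x y : H} (hxy : (x, y) ∈ A.graph) :
    Integrable (fun l : ℝ => l ^ 2) (E.scalarMeasure x) :=
  (h.1 x).1 (LinearPMap.mem_domain_of_mem_graph hxy)

lemma Represents.integrable (h : E.Represents A) {x y : H} (hxy : (x, y) ∈ A.graph) :
    Integrable (fun l : ℝ => l) (E.scalarMeasure x) :=
  integrable_id_of_sq (h.integrable_sq hxy)

lemma Represents.inner_eq (h : E.Represents A) {x y : H} (hxy : (x, y) ∈ A.graph) :
    ⟪x, y⟫_ℂ = ((∫ l : ℝ, l ∂(E.scalarMeasure x) : ℝ) : ℂ) := by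
  obtain ⟨z, rfl, rfl⟩ := (LinearPMap.mem_graph_iff A).1 hxy
  exact h.2 z

lemma Represents.exists_graph (h : E.Represents A) {x : H}
    (hx : Integrable (fun l : ℝ => l ^ 2) (E.scalarMeasure x)) : ∃ y, (x, y) ∈ A.graph :=
  ⟨A ⟨x, (h.1 x).2 hx⟩, A.mem_graph ⟨x, (h.1 x).2 hx⟩⟩

lemma Represents.exists_graph_of_subset_Icc (h : E.Represents A) {B : Set ℝ} {a b : ℝ}
    (hB : MeasurableSet B) (hab : B ⊆ Set.Icc a b) {x : H} (hx : E.proj B x = x) :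
    ∃ y, (x, y) ∈ A.graph := by
  refine h.exists_graph ?_
  rw [← hx, E.scalarMeasure_proj hB]
  have : IntegrableOn (fun l : ℝ => l ^ 2) (Set.Icc a b) (E.scalarMeasure x) :=
    (continuous_pow 2).continuousOn.integrableOn_Icc
  exact this.mono_set hab

lemma tendsto_proj_Icc (E : ProjectionMeasure H) (x : H) :
    Tendsto (fun n : ℕ => E.proj (Set.Icc (-n : ℝ) n) x) atTop (𝓝 x) := by
  have hm : ∀ n : ℕ, MeasurableSet (Set.Icc (-n : ℝ) n) := fun n => measurableSet_Icc
  have h1 : Tendsto (fun n : ℕ => E.scalarMeasure x (Set.Icc (-n : ℝ) n)ᶜ) atTop (𝓝 0) := by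
    have : ⋂ n : ℕ, (Set.Icc (-n : ℝ) n)ᶜ = ∅ := by
      rw [← Set.compl_iUnion, Set.compl_empty_iff, Set.eq_univ_iff_forall]
      intro y
      obtain ⟨n, hn⟩ := exists_nat_ge |y|
      exact Set.mem_iUnion.2 ⟨n, abs_le.1 hn⟩
    rw [← measure_empty (μ := E.scalarMeasure x), ← this]
    refine tendsto_measure_iInter_atTop (fun n => (hm n).compl.nullMeasurableSet) ?_
      ⟨0, measure_ne_top _ _⟩
    intro n m hnm
    have : (n : ℝ) ≤ m := by exact_mod_cast hnm
    exact Set.compl_subset_compl.2 (Set.Icc_subset_Icc (by linarith) this)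
  have h2 : ∀ n : ℕ, (E.scalarMeasure x (Set.Icc (-n : ℝ) n)ᶜ).toReal
      = ‖E.proj (Set.Icc (-n : ℝ) n) x - x‖ ^ 2 := fun n => by
    rw [E.scalarMeasure_apply _ (hm n).compl, ENNReal.toReal_ofReal (by positivity)]
    congr 1
    rw [← norm_neg]
    congr 1
    have := E.proj_add_proj_compl (hm n) x
    rw [neg_eq_iff_add_eq_zero, add_sub, add_comm, this, sub_self]
  have h3 := (ENNReal.tendsto_toReal ENNReal.zero_ne_top).comp h1
  rw [tendsto_iff_norm_sub_tendsto_zero]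
  have h4 := h3.sqrt
  simpa [Function.comp_def, h2, Real.sqrt_sq] using h4

/-- `Represents` ties only the domain and the quadratic form of `A` to `E`, so that `E` reduces `A`
has to be extracted from the form. The scalar measures of `x` and `c • y` add, hence the two cross
terms of the form sum to zero; `c = 1` and `c = I` together separate them. -/
lemma Represents.inner_eq_zero (h : E.Represents A) {B : Set ℝ} (hB : MeasurableSet B)
    {x x' y y' : H} (hxx : (x, x') ∈ A.graph) (hyy : (y, y') ∈ A.graph)
    (hx : E.proj B x = x) (hy : E.proj Bᶜ y = y) : ⟪x, y'⟫_ℂ = 0 := by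
  have key : ∀ c : ℂ, ‖c‖ = 1 → ⟪x, c • y'⟫_ℂ + ⟪c • y, x'⟫_ℂ = 0 := by
    intro c hc
    have hcy : (c • y, c • y') ∈ A.graph := A.graph.smul_mem c hyy
    have hs : (x + c • y, x' + c • y') ∈ A.graph := A.graph.add_mem hxx hcy
    have h1 := h.inner_eq hs
    rw [E.scalarMeasure_add hB hx (by rw [map_smul, hy]),
      integral_add_measure (h.integrable hxx) (h.integrable hcy), Complex.ofReal_add,
      ← h.inner_eq hxx, ← h.inner_eq hcy] at h1
    simp only [inner_add_left, inner_add_right] at h1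
    linear_combination h1
  have k1 := key 1 (by simp)
  have k2 := key Complex.I (by simp)
  simp only [inner_smul_left, inner_smul_right, one_smul, Complex.conj_I] at k1 k2
  have : 2 * Complex.I * ⟪x, y'⟫_ℂ = 0 := by linear_combination k2 + Complex.I * k1
  simpa using this

lemma Represents.proj_eq_zero (h : E.Represents A) {B : Set ℝ} (hB : MeasurableSet B)
    {y y' : H} (hyy : (y, y') ∈ A.graph) (hy : E.proj Bᶜ y = y) : E.proj B y' = 0 := by
  rw [← inner_self_eq_zero (𝕜 := ℂ), ← E.inner_proj_left hB, E.proj_proj_self hB]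
  set z := E.proj B y'
  have hz : E.proj B z = z := E.proj_proj_self hB _
  -- Nothing places `z` in the domain, but its truncations to bounded spectral windows lie there and
  -- converge to `z`.
  have h1 : ∀ n : ℕ, ⟪E.proj (Set.Icc (-n : ℝ) n) z, y'⟫_ℂ = 0 := fun n => by
    have hm : MeasurableSet (Set.Icc (-n : ℝ) n) := measurableSet_Icc
    obtain ⟨w, hw⟩ := h.exists_graph_of_subset_Icc hm subset_rfl (E.proj_proj_self hm z)
    refine h.inner_eq_zero hB hw hyy ?_ hy
    rw [E.proj_proj hB hm, Set.inter_comm, ← E.proj_proj hm hB, hz]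
  have h2 := ((E.tendsto_proj_Icc z).inner (tendsto_const_nhds (x := y'))).congr h1
  exact tendsto_nhds_unique h2 tendsto_const_nhds

/-- Spectral projections reduce the operator. -/
lemma Represents.proj_mem_graph (h : E.Represents A) {B : Set ℝ} (hB : MeasurableSet B)
    {x y : H} (hxy : (x, y) ∈ A.graph) : (E.proj B x, E.proj B y) ∈ A.graph := by
  have h0 : ∀ C, MeasurableSet C → ∃ z, (E.proj C x, z) ∈ A.graph := fun C hC =>
    h.exists_graph (by
      rw [E.scalarMeasure_proj hC]
      exact (h.integrable_sq hxy).mono_measure Measure.restrict_le_self)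
  obtain ⟨u, hu⟩ := h0 B hB
  obtain ⟨v, hv⟩ := h0 Bᶜ hB.compl
  have huv : (x, u + v) ∈ A.graph := by
    have := A.graph.add_mem hu hv
    rwa [Prod.mk_add_mk, E.proj_add_proj_compl hB] at this
  have hy : y = u + v := LinearPMap.mem_graph_snd_inj _ hxy huv rfl
  have h1 : E.proj B v = 0 := h.proj_eq_zero hB hv (E.proj_proj_self hB.compl x)
  have h2 : E.proj Bᶜ u = 0 := h.proj_eq_zero hB.compl hu (by
    rw [compl_compl]; exact E.proj_proj_self hB x)
  have h3 : E.proj B u = u := by simpa [h2] using E.proj_add_proj_compl hB u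
  rwa [hy, map_add, h1, h3, add_zero]

lemma Represents.re_inner_shift (h : E.Represents A) {x y : H} (hxy : (x, y) ∈ A.graph) (c : ℝ) :
    ⟪x, y - (c : ℂ) • x⟫_ℂ = ((∫ l : ℝ, (l - c) ∂(E.scalarMeasure x) : ℝ) : ℂ) := by
  rw [inner_sub_right, h.inner_eq hxy, inner_smul_right, inner_self_eq_norm_sq_to_K,
    integral_sub (h.integrable hxy) (integrable_const _), integral_const,
    scalarMeasure_univ_toReal, smul_eq_mul]
  push_cast
  ring_nf
  rfl

lemma Represents.inner_shift_bound (h : E.Represents A) {c r : ℝ} {x y : H}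
    (hxy : (x, y) ∈ A.graph) (hx : E.proj (Set.Icc (c - r) (c + r)) x = x) :
    |(⟪x, y - (c : ℂ) • x⟫_ℂ).re| ≤ r * ‖x‖ ^ 2 := by
  rw [h.re_inner_shift hxy, Complex.ofReal_re, ← E.scalarMeasure_univ_toReal, ← Real.norm_eq_abs]
  refine norm_integral_le_of_norm_le_const ?_
  rw [← hx, E.scalarMeasure_proj measurableSet_Icc]
  refine ae_restrict_of_forall_mem measurableSet_Icc fun l hl => ?_
  rw [Real.norm_eq_abs, abs_le]
  constructor <;> linarith [hl.1, hl.2]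

/-- Polarization of a quadratic form with real values. -/
lemma Represents.symm (h : E.Represents A) {x x' y y' : H} (hx : (x, x') ∈ A.graph)
    (hy : (y, y') ∈ A.graph) : ⟪x', y⟫_ℂ = ⟪x, y'⟫_ℂ := by
  have real : ∀ {u v : H}, (u, v) ∈ A.graph → ⟪u, v⟫_ℂ = ⟪v, u⟫_ℂ := fun {u v} huv => by
    rw [← inner_conj_symm v u, h.inner_eq huv, Complex.conj_ofReal]
  have hcx := real hx
  have hcy := real hy
  have h1 := real (A.graph.add_mem hx hy)
  have h2 := real (A.graph.add_mem hx (A.graph.smul_mem Complex.I hy))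
  simp only [Prod.smul_mk, inner_add_left, inner_add_right, inner_smul_left, inner_smul_right,
    Complex.conj_I] at h1 h2
  have h3 : Complex.I * (2 * (⟪x', y⟫_ℂ - ⟪x, y'⟫_ℂ)) = 0 := by
    linear_combination (Complex.I + 1) * hcx - Complex.I * h1 - h2
      + (Complex.I - Complex.I ^ 2) * hcy
  have h4 : ⟪x', y⟫_ℂ - ⟪x, y'⟫_ℂ = 0 := by simpa using h3
  exact sub_eq_zero.1 h4

/-- For a symmetric operator a bound on the form is a bound on the norm. With `z = (A - c) x`, the
forms of `A - c` at `x + t z` and `x - t z` differ by 4t‖z‖², while the form bound and the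
parallelogram law allow at most r(2‖x‖² + 2t²‖z‖²). The choice `t = ‖x‖ / ‖z‖` balances the two
terms. The vector `z` is in the domain because it stays in the bounded spectral window. -/
lemma Represents.norm_shift_le (h : E.Represents A) {c r : ℝ} (hr : 0 ≤ r) {x y : H}
    (hxy : (x, y) ∈ A.graph) (hx : E.proj (Set.Icc (c - r) (c + r)) x = x) :
    ‖y - (c : ℂ) • x‖ ≤ r * ‖x‖ := by
  set I := Set.Icc (c - r) (c + r)
  have hI : MeasurableSet I := measurableSet_Icc
  have hy : E.proj I y = y := by
    have := h.proj_mem_graph hI hxy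
    rw [hx] at this
    exact LinearPMap.mem_graph_snd_inj _ this hxy rfl
  set z := y - (c : ℂ) • x with hz
  have hIz : E.proj I z = z := by rw [hz, map_sub, map_smul, hy, hx]
  obtain ⟨w, hw⟩ := h.exists_graph_of_subset_Icc hI subset_rfl hIz
  rcases (norm_nonneg z).eq_or_lt with h0 | h0
  · rw [← h0]; positivity
  have key : ∀ t : ℝ, 4 * (t * ‖z‖ ^ 2) ≤ r * (2 * ‖x‖ ^ 2 + 2 * (t ^ 2 * ‖z‖ ^ 2)) := by
    intro t
    have htz : ((t : ℂ) • z, (t : ℂ) • w) ∈ A.graph := A.graph.smul_mem _ hw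
    have hp := h.inner_shift_bound (c := c) (r := r) (A.graph.add_mem hxy htz)
      (by rw [map_add, map_smul, hx, hIz])
    have hm := h.inner_shift_bound (c := c) (r := r) (A.graph.sub_mem hxy htz)
      (by rw [map_sub, map_smul, hx, hIz])
    have hpar := parallelogram_law_with_norm ℂ x ((t : ℂ) • z)
    have hnt : ‖(t : ℂ) • z‖ * ‖(t : ℂ) • z‖ = t ^ 2 * ‖z‖ ^ 2 := by
      rw [norm_smul, Complex.norm_real, Real.norm_eq_abs, ← sq, mul_pow, sq_abs]
    have hsym := h.symm hxy htz
    have e : ⟪x + (t : ℂ) • z, y + (t : ℂ) • w - (c : ℂ) • (x + (t : ℂ) • z)⟫_ℂ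
        - ⟪x - (t : ℂ) • z, y - (t : ℂ) • w - (c : ℂ) • (x - (t : ℂ) • z)⟫_ℂ
        = 2 * (⟪(t : ℂ) • z, z⟫_ℂ + ⟪z, (t : ℂ) • z⟫_ℂ) := by
      have hxw : ⟪x, (t : ℂ) • w⟫_ℂ = ⟪z, (t : ℂ) • z⟫_ℂ + c * ⟪x, (t : ℂ) • z⟫_ℂ := by
        rw [← hsym, hz, inner_sub_left, inner_smul_left (r := (c : ℂ)), Complex.conj_ofReal]
        ring
      conv_rhs => rw [hz, inner_sub_right (x := (t : ℂ) • (y - (c : ℂ) • x)), ← hz]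
      simp only [inner_add_left, inner_sub_left, inner_add_right, inner_sub_right, smul_add,
        smul_sub, inner_smul_right (r := (c : ℂ)), hxw]
      ring
    have e2 : (⟪(t : ℂ) • z, z⟫_ℂ + ⟪z, (t : ℂ) • z⟫_ℂ).re = 2 * (t * ‖z‖ ^ 2) := by
      rw [inner_smul_left, inner_smul_right, Complex.conj_ofReal, inner_self_eq_norm_sq_to_K]
      simp only [Complex.coe_algebraMap, ← Complex.ofReal_pow, ← Complex.ofReal_mul,
        Complex.add_re, Complex.ofReal_re]
      ring
    have e3 := congrArg Complex.re e
    rw [Complex.sub_re, show (2 : ℂ) = ((2 : ℝ) : ℂ) by norm_num, Complex.re_ofReal_mul, e2] at e3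
    have a1 := (abs_le.1 hp).2
    have a2 := (abs_le.1 hm).1
    nlinarith [a1, a2, e3, hpar, hnt]
  have k := key (‖x‖ / ‖z‖)
  have e1 : ‖x‖ / ‖z‖ * ‖z‖ ^ 2 = ‖x‖ * ‖z‖ := by field_simp
  have e2 : (‖x‖ / ‖z‖) ^ 2 * ‖z‖ ^ 2 = ‖x‖ ^ 2 := by field_simp
  rw [e1, e2] at k
  rcases (norm_nonneg x).eq_or_lt with hx0 | hx0
  · have hx0' : x = 0 := norm_eq_zero.1 hx0.symm
    have hy0 : y = 0 := A.graph_fst_eq_zero_snd (hx0' ▸ hxy) rfl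
    rw [hz, hx0', hy0]
    simp
  · nlinarith

/-- Let `u` and `v` be the spectral parts of `x` above and below `c`. The form of `A - c` is at
least `s‖u‖²` at `u` and at most `-s‖v‖²` at `v`, so pairing `(A - c) x` with `u - v`, which has the
norm of `x`, gives at least `s‖x‖²`. Cauchy-Schwarz concludes. -/
lemma Represents.le_norm_shift (h : E.Represents A) {c s : ℝ} (hs : 0 < s) {x y : H}
    (hxy : (x, y) ∈ A.graph) (hx : E.proj (Set.Icc (c - s) (c + s))ᶜ x = x) :
    s * ‖x‖ ≤ ‖y - (c : ℂ) • x‖ := by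
  set J := (Set.Icc (c - s) (c + s))ᶜ with hJ
  have mJ : MeasurableSet J := measurableSet_Icc.compl
  have hp := h.proj_mem_graph (measurableSet_Ioi (a := c)) hxy
  have hm := h.proj_mem_graph (measurableSet_Ioi (a := c)).compl hxy
  have sp := E.proj_add_proj_compl (measurableSet_Ioi (a := c)) x
  have sq' := E.proj_add_proj_compl (measurableSet_Ioi (a := c)) y
  have pp := E.proj_proj_self (measurableSet_Ioi (a := c)) x
  have pm := E.proj_proj_self (measurableSet_Ioi (a := c)).compl x
  have qp := E.proj_proj_self (measurableSet_Ioi (a := c)) y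
  have qm := E.proj_proj_self (measurableSet_Ioi (a := c)).compl y
  have jp : E.proj J (E.proj (Set.Ioi c) x) = E.proj (Set.Ioi c) x := by
    rw [E.proj_proj mJ measurableSet_Ioi, Set.inter_comm, ← E.proj_proj measurableSet_Ioi mJ, hx]
  have jm : E.proj J (E.proj (Set.Ioi c)ᶜ x) = E.proj (Set.Ioi c)ᶜ x := by
    rw [E.proj_proj mJ measurableSet_Ioi.compl, Set.inter_comm,
      ← E.proj_proj measurableSet_Ioi.compl mJ, hx]
  generalize E.proj (Set.Ioi c) x = u at *
  generalize E.proj (Set.Ioi c)ᶜ x = v at *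
  generalize E.proj (Set.Ioi c) y = u' at *
  generalize E.proj (Set.Ioi c)ᶜ y = v' at *
  have bp : s * ‖u‖ ^ 2 ≤ (⟪u, u' - (c : ℂ) • u⟫_ℂ).re := by
    rw [h.re_inner_shift hp, Complex.ofReal_re, ← E.scalarMeasure_univ_toReal, mul_comm,
      ← smul_eq_mul, ← integral_const]
    refine integral_mono_ae (integrable_const _) ((h.integrable hp).sub (integrable_const _)) ?_
    rw [← pp, ← jp, E.scalarMeasure_proj measurableSet_Ioi, E.scalarMeasure_proj mJ,
      Measure.restrict_restrict measurableSet_Ioi]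
    refine ae_restrict_of_forall_mem (measurableSet_Ioi.inter mJ) fun l hl => ?_
    have h1 : c < l := hl.1
    by_contra hc
    exact hl.2 ⟨by linarith, by simp only [not_le] at hc; linarith⟩
  have bm : s * ‖v‖ ^ 2 ≤ -(⟪v, v' - (c : ℂ) • v⟫_ℂ).re := by
    rw [h.re_inner_shift hm, Complex.ofReal_re, ← E.scalarMeasure_univ_toReal, mul_comm,
      ← smul_eq_mul, ← integral_const, ← integral_neg]
    refine integral_mono_ae (integrable_const _) ((h.integrable hm).sub (integrable_const _)).neg ?_
    rw [← pm, ← jm, E.scalarMeasure_proj measurableSet_Ioi.compl, E.scalarMeasure_proj mJ,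
      Measure.restrict_restrict measurableSet_Ioi.compl]
    refine ae_restrict_of_forall_mem (measurableSet_Ioi.compl.inter mJ) fun l hl => ?_
    have h1 : l ≤ c := not_lt.1 hl.1
    by_contra hc
    exact hl.2 ⟨by simp only [not_le] at hc; linarith, by linarith⟩
  have huv : ⟪u, v⟫_ℂ = 0 := E.inner_eq_zero_of_compl measurableSet_Ioi pp pm
  have hvu : ⟪v, u⟫_ℂ = 0 := inner_eq_zero_symm.1 huv
  have huv' : ⟪u, v'⟫_ℂ = 0 := E.inner_eq_zero_of_compl measurableSet_Ioi pp qm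
  have hvu' : ⟪v, u'⟫_ℂ = 0 :=
    inner_eq_zero_symm.1 (E.inner_eq_zero_of_compl measurableSet_Ioi qp pm)
  have hn : ‖x‖ ^ 2 = ‖u‖ ^ 2 + ‖v‖ ^ 2 := by
    have := norm_add_sq_eq_norm_sq_add_norm_sq_of_inner_eq_zero (𝕜 := ℂ) _ _ huv
    rw [sp] at this; linarith
  have hn' : ‖u - v‖ ^ 2 = ‖u‖ ^ 2 + ‖v‖ ^ 2 := by
    rw [@norm_sub_sq ℂ, huv]
    simp
  have hw : ‖u - v‖ = ‖x‖ := by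
    rw [← sq_eq_sq₀ (norm_nonneg _) (norm_nonneg _), hn, hn']
  have e : ⟪u - v, y - (c : ℂ) • x⟫_ℂ
      = ⟪u, u' - (c : ℂ) • u⟫_ℂ - ⟪v, v' - (c : ℂ) • v⟫_ℂ := by
    rw [← sp, ← sq']
    simp only [inner_add_right, inner_sub_left, inner_sub_right, inner_smul_right, huv, hvu, huv',
      hvu']
    ring
  have hcs : (⟪u - v, y - (c : ℂ) • x⟫_ℂ).re ≤ ‖u - v‖ * ‖y - (c : ℂ) • x‖ :=
    (Complex.re_le_norm _).trans (norm_inner_le_norm _ _)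
  rw [e, Complex.sub_re, hw] at hcs
  rcases (norm_nonneg x).eq_or_lt with hx0 | hx0
  · rw [← hx0, mul_zero]; positivity
  · nlinarith

variable {F : ProjectionMeasure H}

/-- Both projections reduce `A`, so `T = F(J) E(I)` intertwines `A - c`, which is bounded by `r` on
the range of `E(I)` and bounded below by `s` on that of `F(J)`. Hence s‖T‖ ≤ r‖T‖ with r < s. -/
lemma Represents.proj_compl_proj_eq_zero (hE : E.Represents A) (hF : F.Represents A) {c r s : ℝ}
    (hr : 0 ≤ r) (hrs : r < s) (ψ : H) :
    F.proj (Set.Icc (c - s) (c + s))ᶜ (E.proj (Set.Icc (c - r) (c + r)) ψ) = 0 := by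
  set I := Set.Icc (c - r) (c + r)
  set J := (Set.Icc (c - s) (c + s))ᶜ
  have mI : MeasurableSet I := measurableSet_Icc
  have mJ : MeasurableSet J := measurableSet_Icc.compl
  set T := F.proj J ∘L E.proj I
  have hT : ∀ φ, s * ‖T φ‖ ≤ ‖T‖ * r * ‖φ‖ := by
    intro φ
    have hI : E.proj I (E.proj I φ) = E.proj I φ := E.proj_proj_self mI φ
    obtain ⟨y, hy⟩ := hE.exists_graph_of_subset_Icc mI subset_rfl hI
    have hIy : E.proj I y = y := by
      have := hE.proj_mem_graph mI hy
      rw [hI] at this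
      exact LinearPMap.mem_graph_snd_inj _ this hy rfl
    have h1 := hF.le_norm_shift (hr.trans_lt hrs) (hF.proj_mem_graph mJ hy)
      (F.proj_proj_self mJ _)
    have h2 : F.proj J y - (c : ℂ) • F.proj J (E.proj I φ) = T (y - (c : ℂ) • E.proj I φ) := by
      simp only [T, ContinuousLinearMap.comp_apply, map_sub, map_smul, hIy, hI]
    rw [h2] at h1
    calc s * ‖T φ‖ ≤ ‖T (y - (c : ℂ) • E.proj I φ)‖ := h1
      _ ≤ ‖T‖ * ‖y - (c : ℂ) • E.proj I φ‖ := T.le_opNorm _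
      _ ≤ ‖T‖ * (r * ‖E.proj I φ‖) := by gcongr; exact hE.norm_shift_le hr hy hI
      _ ≤ ‖T‖ * (r * ‖φ‖) := by gcongr; exact E.norm_proj_le mI φ
      _ = ‖T‖ * r * ‖φ‖ := by ring
  have hs : 0 < s := hr.trans_lt hrs
  have h3 : ‖T‖ ≤ ‖T‖ * r / s := T.opNorm_le_bound (by positivity) fun φ => by
    rw [div_mul_eq_mul_div, le_div_iff₀ hs, mul_comm]
    exact hT φ
  rw [le_div_iff₀ hs] at h3
  have h4 : ‖T‖ = 0 := by nlinarith [norm_nonneg T]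
  change T ψ = 0
  rw [norm_eq_zero.1 h4]
  rfl

/-- The complement of the closed interval is the countable union of the complements of slightly
larger ones, each null for `F.scalarMeasure φ`. -/
lemma Represents.proj_proj_Icc (hE : E.Represents A) (hF : F.Represents A) {c r : ℝ}
    (hr : 0 ≤ r) (ψ : H) :
    F.proj (Set.Icc (c - r) (c + r)) (E.proj (Set.Icc (c - r) (c + r)) ψ)
      = E.proj (Set.Icc (c - r) (c + r)) ψ := by
  set φ := E.proj (Set.Icc (c - r) (c + r)) ψ with hφ
  have h1 : ∀ n : ℕ, F.scalarMeasure φ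
      (Set.Icc (c - (r + 1 / ((n : ℝ) + 1))) (c + (r + 1 / ((n : ℝ) + 1))))ᶜ = 0 := fun n => by
    rw [F.scalarMeasure_apply _ measurableSet_Icc.compl, hφ,
      hE.proj_compl_proj_eq_zero hF hr (lt_add_of_pos_right r Nat.one_div_pos_of_nat)]
    simp
  have h2 : F.scalarMeasure φ (Set.Icc (c - r) (c + r))ᶜ = 0 := by
    refine measure_mono_null (fun l hl => ?_) (measure_iUnion_null h1)
    rw [Set.mem_iUnion]
    by_contra hc
    push Not at hc
    simp only [Set.mem_compl_iff, not_not, Set.mem_Icc] at hc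
    refine hl ⟨le_of_forall_pos_lt_add fun ε hε => ?_, le_of_forall_pos_lt_add fun ε hε => ?_⟩
    · obtain ⟨n, hn⟩ := exists_nat_one_div_lt hε
      linarith [(hc n).1]
    · obtain ⟨n, hn⟩ := exists_nat_one_div_lt hε
      linarith [(hc n).2]
  rw [F.scalarMeasure_apply _ measurableSet_Icc.compl, ENNReal.ofReal_eq_zero] at h2
  have h3 : F.proj (Set.Icc (c - r) (c + r))ᶜ φ = 0 := by
    have h4 : ‖F.proj (Set.Icc (c - r) (c + r))ᶜ φ‖ = 0 := by
      nlinarith [norm_nonneg (F.proj (Set.Icc (c - r) (c + r))ᶜ φ)]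
    exact norm_eq_zero.1 h4
  have h5 := F.proj_add_proj_compl (measurableSet_Icc (a := c - r) (b := c + r)) φ
  rwa [h3, add_zero] at h5

/-- By symmetry in `E` and `F` each range contains the other, and orthogonal projections with the
same range coincide. -/
lemma Represents.proj_Icc_eq (hE : E.Represents A) (hF : F.Represents A) {a b : ℝ}
    (hab : a ≤ b) (ψ : H) : E.proj (Set.Icc a b) ψ = F.proj (Set.Icc a b) ψ := by
  obtain ⟨c, r, hr, rfl, rfl⟩ : ∃ c r : ℝ, 0 ≤ r ∧ a = c - r ∧ b = c + r :=
    ⟨(a + b) / 2, (b - a) / 2, by linarith, by ring, by ring⟩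
  refine ext_inner_left ℂ fun φ => ?_
  rw [← hF.proj_proj_Icc hE hr ψ, ← E.inner_proj_left measurableSet_Icc,
    ← hE.proj_proj_Icc hF hr φ, F.inner_proj_left measurableSet_Icc,
    E.inner_proj_left measurableSet_Icc]

/-- The spectral measure of an operator is unique. -/
theorem Represents.proj_eq (hE : E.Represents A) (hF : F.Represents A) {B : Set ℝ}
    (hB : MeasurableSet B) : E.proj B = F.proj B := by
  have hμ : ∀ ψ, E.scalarMeasure ψ = F.scalarMeasure ψ := fun ψ =>
    Measure.ext_of_Icc _ _ fun a b hab => by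
      rw [E.scalarMeasure_apply _ measurableSet_Icc, F.scalarMeasure_apply _ measurableSet_Icc,
        hE.proj_Icc_eq hF hab]
  have hi : ∀ (G : ProjectionMeasure H) (ψ : H),
      ⟪G.proj B ψ, ψ⟫_ℂ = (((G.scalarMeasure ψ).real B : ℝ) : ℂ) := fun G ψ => by
    have h : ⟪G.proj B ψ, ψ⟫_ℂ = ⟪G.proj B ψ, G.proj B ψ⟫_ℂ := by
      rw [← G.inner_proj_left hB, G.proj_proj_self hB]
    rw [measureReal_def, G.scalarMeasure_apply _ hB, ENNReal.toReal_ofReal (by positivity), h,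
      inner_self_eq_norm_sq_to_K]
    push_cast
    rfl
  refine ContinuousLinearMap.coe_injective ((ext_inner_map _ _).1 fun ψ => ?_)
  change ⟪E.proj B ψ, ψ⟫_ℂ = ⟪F.proj B ψ, ψ⟫_ℂ
  rw [hi E, hi F, hμ]

end Represents

end ProjectionMeasure

lemma spectralProjection_eq {A : H →ₗ.[ℂ] H} {E : ProjectionMeasure H} (hE : E.Represents A)
    {B : Set ℝ} (hB : MeasurableSet B) : spectralProjection A B = E.proj B := by
  have h : ∃ E : ProjectionMeasure H, E.Represents A := ⟨E, hE⟩
  rw [spectralProjection, dif_pos h]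
  exact h.choose_spec.proj_eq hE hB

end Uniqueness

/-! ### Trace class property and trace of a summable series of rank-one operators. -/

section Nuclear

variable {H : Type*} [NormedAddCommGroup H] [InnerProductSpace ℂ H]

open Filter Topology

lemma sum_norm_inner_mul_norm_inner_le {ι : Type*} {e : ι → H} (he : Orthonormal ℂ e) (a b : H)
    (s : Finset ι) : ∑ i ∈ s, ‖⟪b, e i⟫_ℂ‖ * ‖⟪e i, a⟫_ℂ‖ ≤ ‖b‖ * ‖a‖ := by
  have h1 := Real.sum_mul_le_sqrt_mul_sqrt s (fun i => ‖⟪b, e i⟫_ℂ‖) (fun i => ‖⟪e i, a⟫_ℂ‖)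
  refine h1.trans ?_
  gcongr
  · rw [← Real.sqrt_sq (norm_nonneg b)]
    refine Real.sqrt_le_sqrt ?_
    simpa only [norm_inner_symm] using he.sum_inner_products_le (s := s) b
  · rw [← Real.sqrt_sq (norm_nonneg a)]
    exact Real.sqrt_le_sqrt (he.sum_inner_products_le (s := s) a)

variable [CompleteSpace H]

/-- If `D = |S| + δ` with `A = |S|`, then `A - δ ≤ D⁻¹ S* S` and `S D⁻¹` is a contraction. -/
lemma exists_approx_polar (S A : H →L[ℂ] H) (hA : A.IsPositive)
    (hAA : A * A = ContinuousLinearMap.adjoint S * S) {δ : ℝ} (hδ : 0 < δ) :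
    ∃ W : H →L[ℂ] H, (∀ x, ‖W x‖ ≤ ‖x‖) ∧
      ∀ x, (⟪x, A x⟫_ℂ).re ≤ ‖⟪W x, S x⟫_ℂ‖ + δ * ‖x‖ ^ 2 := by
  have hpos : ∀ x, 0 ≤ (⟪x, A x⟫_ℂ).re := fun x => hA.re_inner_nonneg_right x
  have hsa : ∀ x y, ⟪A x, y⟫_ℂ = ⟪x, A y⟫_ℂ := fun x y => hA.isSymmetric x y
  set D : H →L[ℂ] H := A + (δ : ℂ) • 1 with hD
  have hDx : ∀ x, D x = A x + (δ : ℂ) • x := fun x => by simp [hD]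
  have hDre : ∀ x, (⟪x, D x⟫_ℂ).re = (⟪x, A x⟫_ℂ).re + δ * ‖x‖ ^ 2 := fun x => by
    rw [hDx, inner_add_right, inner_smul_right, inner_self_eq_norm_sq_to_K, Complex.add_re]
    congr 1
    rw [Complex.re_ofReal_mul]
    simp [← Complex.ofReal_pow]
  have hu : IsUnit D := by
    refine ContinuousLinearMap.isUnit_of_forall_le_norm_inner_map D (c := ⟨δ, hδ.le⟩) hδ fun x => ?_
    have h1 : (⟪x, D x⟫_ℂ).re ≤ ‖⟪D x, x⟫_ℂ‖ := by
      rw [norm_inner_symm]; exact Complex.re_le_norm _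
    have h2 : ‖x‖ ^ 2 * δ ≤ ‖⟪D x, x⟫_ℂ‖ := by linarith [hDre x, hpos x]
    exact h2
  obtain ⟨u, hu⟩ := hu
  set Y : H →L[ℂ] H := u⁻¹.val with hY
  have hDY : ∀ x, D (Y x) = x := fun x => by
    rw [← hu]
    exact congrArg (fun T : H →L[ℂ] H => T x) (u.mul_inv)
  have hSS : ∀ x y, ⟪S x, S y⟫_ℂ = ⟪A x, A y⟫_ℂ := fun x y => by
    rw [← ContinuousLinearMap.adjoint_inner_right, hsa]
    congr 1
    exact (congrArg (fun T : H →L[ℂ] H => T y) hAA).symm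
  refine ⟨S * Y, fun x => ?_, fun x => ?_⟩
  · have h1 : ‖S (Y x)‖ ^ 2 = ‖A (Y x)‖ ^ 2 := by
      have := hSS (Y x) (Y x)
      rw [inner_self_eq_norm_sq_to_K, inner_self_eq_norm_sq_to_K] at this
      exact_mod_cast this
    have h2 : ‖A (Y x)‖ ^ 2 ≤ ‖x‖ ^ 2 := by
      conv_rhs => rw [← hDY x, hDx, @norm_add_sq ℂ]
      have h3 : RCLike.re ⟪A (Y x), (δ : ℂ) • Y x⟫_ℂ = δ * (⟪Y x, A (Y x)⟫_ℂ).re := by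
        rw [inner_smul_right, hsa]
        exact Complex.re_ofReal_mul _ _
      rw [h3]
      nlinarith [mul_nonneg hδ.le (hpos (Y x)), sq_nonneg ‖(δ : ℂ) • Y x‖]
    exact (sq_le_sq₀ (norm_nonneg _) (norm_nonneg _)).1 (h1.trans_le h2)
  · set z := Y x
    have hx : x = A z + (δ : ℂ) • z := by rw [← hDx, hDY]
    have h1 : ⟪(S * Y) x, S x⟫_ℂ = ⟪A z, A x⟫_ℂ := hSS z x
    have h2 : ⟪x, A x⟫_ℂ = ⟪A z, A x⟫_ℂ + δ * ⟪z, A x⟫_ℂ := by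
      have h0 : ∀ w : H, ⟪x, w⟫_ℂ = ⟪A z, w⟫_ℂ + δ * ⟪z, w⟫_ℂ := fun w => by
        conv_lhs => rw [hx]
        rw [inner_add_left, inner_smul_left, Complex.conj_ofReal]
      exact h0 _
    have h3 : δ * (⟪z, A x⟫_ℂ).re ≤ δ * ‖x‖ ^ 2 := by
      gcongr
      have h4 : ⟪z, A x⟫_ℂ = ⟪A z, A z⟫_ℂ + δ * ⟪z, A z⟫_ℂ := by
        conv_lhs => rw [hx, map_add, map_smul, inner_add_right, inner_smul_right]
        rw [hsa]
      have h5 : ‖x‖ ^ 2 = ‖A z‖ ^ 2 + 2 * (δ * (⟪z, A z⟫_ℂ).re) + ‖(δ : ℂ) • z‖ ^ 2 := by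
        conv_lhs => rw [hx, @norm_add_sq ℂ]
        have h3 : RCLike.re ⟪A z, (δ : ℂ) • z⟫_ℂ = δ * (⟪z, A z⟫_ℂ).re := by
          rw [inner_smul_right, hsa]
          exact Complex.re_ofReal_mul _ _
        rw [h3]
      rw [h4, inner_self_eq_norm_sq_to_K, Complex.add_re, Complex.re_ofReal_mul, h5]
      have h6 := mul_nonneg hδ.le (hpos z)
      have h7 : ((((‖A z‖ : ℝ) : ℂ) ^ 2).re) = ‖A z‖ ^ 2 := by
        rw [← Complex.ofReal_pow, Complex.ofReal_re]
      have h8 := sq_nonneg ‖(δ : ℂ) • z‖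
      change (((‖A z‖ : ℝ) : ℂ) ^ 2).re + _ ≤ _
      linarith
    rw [h1, h2, Complex.add_re, Complex.re_ofReal_mul]
    linarith [Complex.re_le_norm ⟪A z, A x⟫_ℂ]

variable {S : H →L[ℂ] H} {a b : ℕ → H}

/-- Moving `W` across as its adjoint `V` makes every rank-one term a product ⟨b n, e i⟩⟨e i, V (a
n)⟩. Summed over `i` first, it costs at most ‖b n‖‖a n‖ by Cauchy-Schwarz and Bessel, uniformly in
the contraction `W`; the uniformity allows an approximate polar factor depending on δ. -/
lemma sum_norm_inner_le_of_nuclear (hsum : Summable fun n => ‖b n‖ * ‖a n‖)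
    (hS : ∀ f, HasSum (fun n => ⟪b n, f⟫_ℂ • a n) (S f)) {W : H →L[ℂ] H}
    (hW : ∀ x, ‖W x‖ ≤ ‖x‖) {ι : Type*} {e : ι → H} (he : Orthonormal ℂ e) (s : Finset ι) :
    ∑ i ∈ s, ‖⟪W (e i), S (e i)⟫_ℂ‖ ≤ ∑' n, ‖b n‖ * ‖a n‖ := by
  set V := ContinuousLinearMap.adjoint W
  have hV : ‖V‖ ≤ 1 := by
    rw [LinearIsometryEquiv.norm_map]
    exact W.opNorm_le_bound zero_le_one (by simpa using hW)
  have hVa : ∀ n, ‖V (a n)‖ ≤ ‖a n‖ := fun n => by simpa using V.le_of_opNorm_le hV (a n)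
  have h1 : ∀ i, HasSum (fun n => ⟪b n, e i⟫_ℂ * ⟪e i, V (a n)⟫_ℂ) ⟪W (e i), S (e i)⟫_ℂ :=
    fun i => by
      have := (hS (e i)).mapL (innerSL ℂ (W (e i)))
      simpa [inner_smul_right, V, ContinuousLinearMap.adjoint_inner_right] using this
  have h2 : ∀ i ∈ s, Summable fun n => ‖⟪b n, e i⟫_ℂ‖ * ‖⟪e i, V (a n)⟫_ℂ‖ := fun i _ => by
    refine hsum.of_nonneg_of_le (fun n => by positivity) fun n => ?_
    have hi := he.1 i
    gcongr
    · simpa [hi] using norm_inner_le_norm (𝕜 := ℂ) (b n) (e i)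
    · refine le_trans ?_ (hVa n)
      simpa [hi] using norm_inner_le_norm (𝕜 := ℂ) (e i) (V (a n))
  calc ∑ i ∈ s, ‖⟪W (e i), S (e i)⟫_ℂ‖
      ≤ ∑ i ∈ s, ∑' n, ‖⟪b n, e i⟫_ℂ‖ * ‖⟪e i, V (a n)⟫_ℂ‖ := by
        refine Finset.sum_le_sum fun i hi => ?_
        rw [← (h1 i).tsum_eq]
        have h3 : Summable fun n => ‖⟪b n, e i⟫_ℂ * ⟪e i, V (a n)⟫_ℂ‖ := by
          simpa only [norm_mul] using h2 i hi
        simpa only [norm_mul] using norm_tsum_le_tsum_norm h3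
    _ = ∑' n, ∑ i ∈ s, ‖⟪b n, e i⟫_ℂ‖ * ‖⟪e i, V (a n)⟫_ℂ‖ := (Summable.tsum_finsetSum h2).symm
    _ ≤ ∑' n, ‖b n‖ * ‖a n‖ := by
        refine Summable.tsum_le_tsum (fun n => ?_) (summable_sum h2) hsum
        refine (sum_norm_inner_mul_norm_inner_le he (V (a n)) (b n) s).trans ?_
        gcongr
        exact hVa n

theorem isTraceClass_of_nuclear (hsum : Summable fun n => ‖b n‖ * ‖a n‖)
    (hS : ∀ f, HasSum (fun n => ⟪b n, f⟫_ℂ • a n) (S f)) : IsTraceClass S := by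
  intro w e
  set A := CFC.sqrt (ContinuousLinearMap.adjoint S * S)
  have hA : A.IsPositive :=
    (ContinuousLinearMap.nonneg_iff_isPositive _).1 (CFC.sqrt_nonneg _)
  have hAA : A * A = ContinuousLinearMap.adjoint S * S :=
    CFC.sqrt_mul_sqrt_self _ (star_mul_self_nonneg S)
  refine summable_of_sum_le (fun i => hA.re_inner_nonneg_right _) (c := ∑' n, ‖b n‖ * ‖a n‖)
    fun s => ?_
  -- The approximate polar factor costs `δ` per basis vector; for a fixed finite `s` this error
  -- disappears as `δ → 0`.
  have h1 : ∀ δ : ℝ, 0 < δ →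
      ∑ i ∈ s, (⟪e i, A (e i)⟫_ℂ).re ≤ ∑' n, ‖b n‖ * ‖a n‖ + δ * s.card := by
    intro δ hδ
    obtain ⟨W, hW, hWA⟩ := exists_approx_polar S A hA hAA hδ
    calc ∑ i ∈ s, (⟪e i, A (e i)⟫_ℂ).re
        ≤ ∑ i ∈ s, (‖⟪W (e i), S (e i)⟫_ℂ‖ + δ) := by
          refine Finset.sum_le_sum fun i _ => ?_
          simpa [e.orthonormal.1 i] using hWA (e i)
      _ ≤ _ := by
          rw [Finset.sum_add_distrib, Finset.sum_const, nsmul_eq_mul, mul_comm (s.card : ℝ)]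
          gcongr
          exact sum_norm_inner_le_of_nuclear hsum hS hW e.orthonormal s
  have h2 : Tendsto (fun δ : ℝ => ∑' n, ‖b n‖ * ‖a n‖ + δ * s.card) (𝓝[>] 0)
      (𝓝 (∑' n, ‖b n‖ * ‖a n‖ + 0 * s.card)) := by
    refine Tendsto.mono_left ?_ nhdsWithin_le_nhds
    exact (by fun_prop : Continuous fun δ : ℝ => ∑' n, ‖b n‖ * ‖a n‖ + δ * s.card).tendsto 0
  rw [zero_mul, add_zero] at h2
  exact ge_of_tendsto h2 (eventually_mem_nhdsWithin.mono fun δ hδ => h1 δ hδ)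

/-- Absolute summability in both indices permits the exchange of sums, and Parseval collapses the
sum over the basis, whichever basis was chosen. -/
theorem trace_eq_of_nuclear (hsum : Summable fun n => ‖b n‖ * ‖a n‖)
    (hS : ∀ f, HasSum (fun n => ⟪b n, f⟫_ℂ • a n) (S f)) :
    trace S = ∑' n, ⟪b n, a n⟫_ℂ := by
  unfold trace
  generalize (exists_hilbertBasis ℂ H).choose_spec.choose = e
  have h1 : ∀ i, ⟪e i, S (e i)⟫_ℂ = ∑' n, ⟪b n, e i⟫_ℂ * ⟪e i, a n⟫_ℂ := fun i => by
    have := (hS (e i)).mapL (innerSL ℂ (e i))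
    simpa [inner_smul_right] using this.tsum_eq.symm
  have h2 : ∀ n, Summable fun i => ‖⟪b n, e i⟫_ℂ * ⟪e i, a n⟫_ℂ‖ := fun n => by
    simp only [norm_mul]
    exact summable_of_sum_le (fun i => by positivity)
      (sum_norm_inner_mul_norm_inner_le e.orthonormal (a n) (b n))
  have h3 : Summable (Function.uncurry fun n i => ⟪b n, e i⟫_ℂ * ⟪e i, a n⟫_ℂ) := by
    refine Summable.of_norm ((summable_prod_of_nonneg fun _ => norm_nonneg _).2 ⟨h2, ?_⟩)
    refine hsum.of_nonneg_of_le (fun n => tsum_nonneg fun _ => norm_nonneg _) fun n => ?_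
    refine (h2 n).tsum_le_of_sum_le fun s => ?_
    simpa only [Function.uncurry, norm_mul] using
      sum_norm_inner_mul_norm_inner_le e.orthonormal (a n) (b n) s
  calc _ = ∑' i, ∑' n, ⟪b n, e i⟫_ℂ * ⟪e i, a n⟫_ℂ := tsum_congr h1
    _ = ∑' n, ∑' i, ⟪b n, e i⟫_ℂ * ⟪e i, a n⟫_ℂ := h3.tsum_comm
    _ = _ := tsum_congr fun n => e.tsum_inner_mul_inner _ _

end Nuclear

/-! ### The du Bois-Reymond lemma. -/

section DuBoisReymond

open Set Filter Topology
open scoped ContDiff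

/-- The du Bois-Reymond lemma: a function whose distributional derivative vanishes on an open
interval is constant there. -/
theorem ae_eq_const_of_integral_deriv_smul_eq_zero {F : Type*} [NormedAddCommGroup F]
    [NormedSpace ℝ F] [CompleteSpace F] {U : Set ℝ} (hU : IsOpen U) (hc : U.OrdConnected)
    {f : ℝ → F} (hf : LocallyIntegrableOn f U)
    (h : ∀ χ : ℝ → ℝ, ContDiff ℝ ∞ χ → HasCompactSupport χ → tsupport χ ⊆ U →
      ∫ x, deriv χ x • f x = 0) :
    ∃ c : F, ∀ᵐ x, x ∈ U → f x = c := by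
  rcases U.eq_empty_or_nonempty with rfl | ⟨x₀, hx₀⟩
  · exact ⟨0, by simp⟩
  have hint : ∀ g : ℝ → ℝ, ContDiff ℝ ∞ g → HasCompactSupport g → tsupport g ⊆ U →
      Integrable fun x => g x • f x := by
    intro g hg hgc hgU
    have h1 : IntegrableOn (fun x => g x • f x) (tsupport g) :=
      (hf.integrableOn_compact_subset hgU hgc).continuousOn_smul hg.continuous.continuousOn hgc
    refine (integrableOn_iff_integrable_of_support_subset ?_).1 h1
    exact (Function.support_smul_subset_left g f).trans (subset_tsupport g)
  obtain ⟨r, hr, hrU⟩ := Metric.isOpen_iff.1 hU x₀ hx₀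
  let β : ContDiffBump x₀ := ⟨r / 4, r / 2, by positivity, by linarith⟩
  set η : ℝ → ℝ := β.normed volume
  have hη : ContDiff ℝ ∞ η := β.contDiff_normed
  have hηc : HasCompactSupport η := β.hasCompactSupport_normed
  have hη1 : ∫ x, η x = 1 := β.integral_normed
  have hηU : tsupport η ⊆ U := by
    rw [β.tsupport_normed_eq]
    refine (Metric.closedBall_subset_ball ?_).trans hrU
    change r / 2 < r
    linarith
  refine ⟨∫ x, η x • f x, ?_⟩
  -- Subtracting `m` times the unit-mass bump `η` from `g` leaves a function of integral zero. Its
  -- primitive `χ` has compact support and is an admissible test function.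
  have key : ∀ g : ℝ → ℝ, ContDiff ℝ ∞ g → HasCompactSupport g → tsupport g ⊆ U →
      ∫ x, g x • (f x - ∫ y, η y • f y) = 0 := by
    intro g hg hgc hgU
    set m := ∫ x, g x
    set ψ : ℝ → ℝ := fun x => g x - m * η x with hψ
    have hψs : ContDiff ℝ ∞ ψ := hg.sub (contDiff_const.mul hη)
    have hgi : Integrable g := hg.continuous.integrable_of_hasCompactSupport hgc
    have hηi : Integrable η := hη.continuous.integrable_of_hasCompactSupport hηc
    have hψ0 : ∫ x, ψ x = 0 := by
      rw [hψ, integral_sub hgi (hηi.const_mul m), integral_const_mul, hη1, mul_one, sub_self]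
    -- The primitive lives on the convex hull `[A, B]` of the supports, which stays in `U` by
    -- order-connectedness; `x₀` makes `K` visibly nonempty.
    set K := insert x₀ (tsupport g ∪ tsupport η)
    have hK : IsCompact K := (hgc.isCompact.union hηc.isCompact).insert x₀
    have hKn : K.Nonempty := insert_nonempty _ _
    have hKU : K ⊆ U := insert_subset hx₀ (union_subset hgU hηU)
    set A := sInf K
    set B := sSup K
    have hAB : Icc A B ⊆ U := hc.out (hKU (hK.sInf_mem hKn)) (hKU (hK.sSup_mem hKn))
    have hψK : ∀ x, x ∉ K → ψ x = 0 := fun x hx => by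
      have h1 : x ∉ tsupport g := fun h => hx (mem_insert_of_mem _ (Or.inl h))
      have h2 : x ∉ tsupport η := fun h => hx (mem_insert_of_mem _ (Or.inr h))
      simp [hψ, image_eq_zero_of_notMem_tsupport h1, image_eq_zero_of_notMem_tsupport h2]
    have hψA : ∀ x, x < A → ψ x = 0 := fun x hx => hψK x fun h =>
      (csInf_le hK.bddBelow h).not_gt hx
    have hψB : ∀ x, B < x → ψ x = 0 := fun x hx => hψK x fun h =>
      (le_csSup hK.bddAbove h).not_gt hx
    set χ : ℝ → ℝ := fun x => ∫ y in A..x, ψ y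
    have hχd : ∀ x, HasDerivAt χ (ψ x) x := fun x =>
      intervalIntegral.integral_hasDerivAt_right (hψs.continuous.intervalIntegrable _ _)
        hψs.continuous.stronglyMeasurable.stronglyMeasurableAtFilter hψs.continuous.continuousAt
    have hχ' : deriv χ = ψ := funext fun x => (hχd x).deriv
    have hχs : ContDiff ℝ ∞ χ := by
      rw [contDiff_infty_iff_deriv, hχ']
      exact ⟨fun x => (hχd x).differentiableAt, hψs⟩
    have hχA : ∀ x, x < A → χ x = 0 := fun x hx => by
      refine (intervalIntegral.integral_congr_ae ?_).trans intervalIntegral.integral_zero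
      have : ∀ᵐ y : ℝ, y ≠ A := by simp [ae_iff, measure_singleton]
      filter_upwards [this] with y hy hyx
      rw [uIoc_of_ge hx.le] at hyx
      exact hψA y (lt_of_le_of_ne hyx.2 hy)
    have hχB : ∀ x, B < x → χ x = 0 := fun x hx => by
      have hAx : A ≤ x :=
        (csInf_le hK.bddBelow (mem_insert x₀ _)).trans
          ((le_csSup hK.bddAbove (mem_insert x₀ _)).trans hx.le)
      have h1 : ∫ y in Ioc A x, ψ y = ∫ y, ψ y := by
        rw [← integral_Icc_eq_integral_Ioc]
        refine setIntegral_eq_integral_of_forall_compl_eq_zero fun y hy => ?_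
        rw [mem_Icc, not_and_or, not_le, not_le] at hy
        rcases hy with hy | hy
        · exact hψA y hy
        · exact hψB y (hx.trans hy)
      change ∫ y in A..x, ψ y = 0
      rw [intervalIntegral.integral_of_le hAx, h1, hψ0]
    have hχsupp : tsupport χ ⊆ Icc A B := by
      refine closure_minimal (fun x hx => ?_) isClosed_Icc
      by_contra hx'
      rw [mem_Icc, not_and_or, not_le, not_le] at hx'
      exact hx (hx'.elim (hχA x) (hχB x))
    have hχc : HasCompactSupport χ := isCompact_Icc.of_isClosed_subset (isClosed_tsupport χ) hχsupp
    have h0 := h χ hχs hχc (hχsupp.trans hAB)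
    rw [hχ'] at h0
    have e1 : ∀ x, ψ x • f x = g x • f x - m • (η x • f x) := fun x => by
      simp only [hψ, sub_smul, mul_smul]
    simp only [e1] at h0
    have hmη : Integrable fun x => m • (η x • f x) := (hint η hη hηc hηU).smul m
    rw [integral_sub (hint g hg hgc hgU) hmη, integral_smul] at h0
    simp only [smul_sub]
    rw [integral_sub (hint g hg hgc hgU) (hgi.smul_const _), integral_smul_const]
    exact h0
  have hloc : LocallyIntegrableOn (fun x => f x - ∫ y, η y • f y) U :=
    hf.sub (locallyIntegrableOn_const _)
  filter_upwards [hU.ae_eq_zero_of_integral_contDiff_smul_eq_zero hloc key] with x hx hxU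
  exact sub_eq_zero.1 (hx hxU)

end DuBoisReymond

/-! ### The inversion unitary on L²(ℝ). -/

section Kelvin

open Filter Topology

lemma measurable_sign_real : Measurable fun x : ℝ => ((SignType.sign x : SignType) : ℝ) := by
  have h : (fun x : ℝ => ((SignType.sign x : SignType) : ℝ)) =
      fun x : ℝ => if 0 < x then 1 else if x < 0 then -1 else 0 := by
    funext x
    rcases lt_trichotomy x 0 with h | h | h
    · simp [h, h.not_gt]
    · simp [h]
    · simp [h]
  rw [h]
  exact Measurable.ite measurableSet_Ioi measurable_const
    (Measurable.ite measurableSet_Iio measurable_const measurable_const)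

/-- The weight `u⁻¹ e^{-i sgn(u) θ/2}`. -/
def invWeight (θ u : ℝ) : ℂ :=
  ((u⁻¹ : ℝ) : ℂ) * Complex.exp (-(Complex.I * (SignType.sign u : ℝ) * (θ / 2)))

lemma measurable_invWeight (θ : ℝ) : Measurable (invWeight θ) := by
  have := measurable_sign_real
  unfold invWeight
  fun_prop

lemma norm_exp_sign (θ u : ℝ) :
    ‖Complex.exp (-(Complex.I * (SignType.sign u : ℝ) * (θ / 2)))‖ = 1 := by
  have : -(Complex.I * ((SignType.sign u : ℝ) : ℂ) * ((θ : ℂ) / 2)) =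
      ((-((SignType.sign u : ℝ) * (θ / 2)) : ℝ) : ℂ) * Complex.I := by
    push_cast; ring
  rw [this, Complex.norm_exp_ofReal_mul_I]

lemma norm_invWeight (θ u : ℝ) : ‖invWeight θ u‖ = |u|⁻¹ := by
  rw [invWeight, norm_mul, norm_exp_sign, mul_one, Complex.norm_real, norm_inv, Real.norm_eq_abs]

/-- `u ↦ u⁻¹ e^{-i sgn(u) θ/2} f(1/u)`. -/
def kelvinFun (θ : ℝ) (f : ℝ → ℂ) (u : ℝ) : ℂ := invWeight θ u * f u⁻¹

lemma sign_inv_real (u : ℝ) : SignType.sign u⁻¹ = SignType.sign u := by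
  rcases lt_trichotomy u 0 with h | h | h
  · rw [sign_neg h, sign_neg (inv_lt_zero.2 h)]
  · simp [h]
  · rw [sign_pos h, sign_pos (inv_pos.2 h)]

lemma kelvinFun_neg_kelvinFun (θ : ℝ) (f : ℝ → ℂ) {u : ℝ} (hu : u ≠ 0) :
    kelvinFun (-θ) (kelvinFun θ f) u = f u := by
  have hu' : (u : ℂ) ≠ 0 := by exact_mod_cast hu
  rw [kelvinFun, kelvinFun, invWeight, invWeight, sign_inv_real, inv_inv]
  have h : Complex.exp (-(Complex.I * ((SignType.sign u : ℝ) : ℂ) * (((-θ : ℝ) : ℂ) / 2))) *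
      Complex.exp (-(Complex.I * ((SignType.sign u : ℝ) : ℂ) * ((θ : ℂ) / 2))) = 1 := by
    rw [← Complex.exp_add, ← Complex.exp_zero]
    congr 1
    push_cast; ring
  calc _ = (((u⁻¹ : ℝ) : ℂ) * u) *
      (Complex.exp (-(Complex.I * ((SignType.sign u : ℝ) : ℂ) * (((-θ : ℝ) : ℂ) / 2))) *
      Complex.exp (-(Complex.I * ((SignType.sign u : ℝ) : ℂ) * ((θ : ℂ) / 2)))) * f u := by ring
    _ = f u := by rw [h]; push_cast; field_simp

lemma ae_ne_zero_real : ∀ᵐ u : ℝ, u ≠ 0 := by simp [ae_iff, measure_singleton]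

/-- Inversion is differentiable off `0`, so it carries null sets to null sets; composition with it
is then well defined on classes modulo null sets. -/
lemma quasiMeasurePreserving_inv_real :
    Measure.QuasiMeasurePreserving (fun u : ℝ => u⁻¹) volume volume := by
  refine ⟨measurable_inv, Measure.AbsolutelyContinuous.mk fun N hN h0 => ?_⟩
  rw [Measure.map_apply measurable_inv hN]
  have h1 : volume ((fun u : ℝ => u⁻¹) '' (N \ {0})) = 0 :=
    addHaar_image_eq_zero_of_differentiableOn_of_addHaar_eq_zero volume
      (differentiableOn_inv.mono fun x hx => hx.2) (measure_mono_null Set.sdiff_subset h0)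
  refine measure_mono_null (fun u hu => ?_)
    (measure_union_null h1 (measure_singleton (0 : ℝ)))
  rcases eq_or_ne u 0 with h | h
  · exact Or.inr h
  · exact Or.inl ⟨u⁻¹, ⟨hu, inv_ne_zero h⟩, inv_inv u⟩

lemma kelvinFun_congr (θ : ℝ) {f g : ℝ → ℂ} (h : f =ᵐ[volume] g) :
    kelvinFun θ f =ᵐ[volume] kelvinFun θ g := by
  filter_upwards [quasiMeasurePreserving_inv_real.ae_eq_comp h] with u hu
  exact congrArg (invWeight θ u * ·) hu

/-- The squared modulus u⁻² of the weight is the Jacobian of u ↦ 1/u. -/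
lemma lintegral_kelvinFun (θ : ℝ) (f : ℝ → ℂ) :
    ∫⁻ u, ‖kelvinFun θ f u‖ₑ ^ (2 : ℝ) = ∫⁻ x, ‖f x‖ₑ ^ (2 : ℝ) := by
  have himg : (fun u : ℝ => u⁻¹) '' {0}ᶜ = {0}ᶜ := by
    ext x
    refine ⟨?_, fun hx => ⟨x⁻¹, inv_ne_zero hx, inv_inv x⟩⟩
    rintro ⟨y, hy, rfl⟩
    exact inv_ne_zero hy
  have hn : ∀ g : ℝ → ℝ≥0∞, ∫⁻ x in {0}ᶜ, g x = ∫⁻ x, g x := fun g => by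
    rw [Measure.restrict_eq_self_of_ae_mem]
    exact ae_ne_zero_real
  have h1 := lintegral_image_eq_lintegral_abs_deriv_mul (s := ({0}ᶜ : Set ℝ))
    (f := fun u : ℝ => u⁻¹) (f' := fun u => -(u ^ 2)⁻¹) (measurableSet_singleton 0).compl
    (fun x hx => (hasDerivAt_inv hx).hasDerivWithinAt) inv_injective.injOn
    (fun x => ‖f x‖ₑ ^ (2 : ℝ))
  rw [himg, hn, hn] at h1
  rw [h1]
  refine lintegral_congr fun u => ?_
  rw [kelvinFun, enorm_mul, ENNReal.mul_rpow_of_nonneg _ _ (by norm_num)]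
  congr 1
  rw [← ofReal_norm, norm_invWeight, ENNReal.ofReal_rpow_of_nonneg (by positivity)
    (by norm_num)]
  congr 1
  rw [abs_neg, abs_inv, abs_of_nonneg (sq_nonneg u), Real.rpow_two, inv_pow, sq_abs]

lemma eLpNorm_kelvinFun (θ : ℝ) (f : ℝ → ℂ) :
    eLpNorm (kelvinFun θ f) 2 volume = eLpNorm f 2 volume := by
  simp only [eLpNorm_eq_lintegral_rpow_enorm_toReal (p := 2) two_ne_zero ENNReal.ofNat_ne_top,
    ENNReal.toReal_ofNat, lintegral_kelvinFun]

lemma memLp_kelvinFun (θ : ℝ) {f : ℝ → ℂ} (hf : MemLp f 2 volume) :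
    MemLp (kelvinFun θ f) 2 volume :=
  ⟨(measurable_invWeight θ).aestronglyMeasurable.mul
    (hf.1.comp_quasiMeasurePreserving quasiMeasurePreserving_inv_real),
    by rw [eLpNorm_kelvinFun]; exact hf.2⟩

/-- The unitary `f ↦ u⁻¹ e^{-i sgn(u) θ/2} f(1/u)` as an isometry of `L²(ℝ)`. -/
def kelvinIsometry (θ : ℝ) : L2 →ₗᵢ[ℂ] L2 where
  toFun f := (memLp_kelvinFun θ (Lp.memLp f)).toLp _
  map_add' f g := by
    rw [← MemLp.toLp_add]
    refine MemLp.toLp_congr _ _ ((kelvinFun_congr θ (Lp.coeFn_add f g)).trans ?_)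
    exact .of_forall fun u => by simp [kelvinFun, mul_add]
  map_smul' c f := by
    rw [RingHom.id_apply, ← MemLp.toLp_const_smul]
    refine MemLp.toLp_congr _ _ ((kelvinFun_congr θ (Lp.coeFn_smul c f)).trans ?_)
    exact .of_forall fun u => by simp [kelvinFun, mul_left_comm]
  norm_map' f := by
    change ‖(memLp_kelvinFun θ (Lp.memLp f)).toLp _‖ = ‖f‖
    rw [Lp.norm_toLp, eLpNorm_kelvinFun, Lp.norm_def]

lemma coeFn_kelvinIsometry (θ : ℝ) (f : L2) :
    kelvinIsometry θ f =ᵐ[volume] kelvinFun θ f :=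
  (memLp_kelvinFun θ (Lp.memLp f)).coeFn_toLp

lemma kelvinIsometry_neg_apply (θ : ℝ) (f : L2) : kelvinIsometry (-θ) (kelvinIsometry θ f) = f := by
  refine Lp.ext ((coeFn_kelvinIsometry _ _).trans ?_)
  refine (kelvinFun_congr (-θ) (coeFn_kelvinIsometry θ f)).trans ?_
  filter_upwards [ae_ne_zero_real] with u hu
  exact kelvinFun_neg_kelvinFun θ f hu

/-- The unitary `f ↦ u⁻¹ e^{-i sgn(u) θ/2} f(1/u)` of `L²(ℝ)`. -/
def kelvin (θ : ℝ) : L2 ≃ₗᵢ[ℂ] L2 :=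
  LinearIsometryEquiv.ofSurjective (kelvinIsometry θ) fun f =>
    ⟨kelvinIsometry (-θ) f, by simpa using kelvinIsometry_neg_apply (-θ) f⟩

lemma coeFn_kelvin (θ : ℝ) (f : L2) : kelvin θ f =ᵐ[volume] kelvinFun θ f :=
  coeFn_kelvinIsometry θ f

/-- The unitary that diagonalizes `Π_θ`: `kelvin θ` followed by the Fourier transform. -/
def diagonalizer (θ : ℝ) : L2 ≃ₗᵢ[ℂ] L2 :=
  (kelvin θ).trans (Lp.fourierTransformₗᵢ ℝ ℂ)

end Kelvin

/-! ### The weak form of -i d/du, and its diagonalization by the Fourier transform. -/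

section WeakGraph

open Filter Topology FourierTransform
open scoped ContDiff ComplexConjugate

lemma inner_L2_eq_integral {f g : L2} {F G : ℝ → ℂ} (hf : f =ᵐ[volume] F) (hg : g =ᵐ[volume] G) :
    ⟪f, g⟫_ℂ = ∫ u, conj (F u) * G u := by
  rw [L2.inner_def]
  refine integral_congr_ae ?_
  filter_upwards [hf, hg] with u h1 h2
  rw [h1, h2, RCLike.inner_apply, mul_comm]

lemma integrable_conj_mul {F G : ℝ → ℂ} (hF : MemLp F 2 volume) (hG : MemLp G 2 volume) :
    Integrable fun u => conj (F u) * G u := by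
  have h := hF.star.integrable_mul hG
  exact h

/-- Integration by parts against a function with weak derivative `i m`, differentiable off `0`. -/
lemma integral_conj_deriv_mul_eq {k m : ℝ → ℂ} (hk : MemLp k 2 volume) (hm : MemLp m 2 volume)
    (hkc : Continuous k) (hkd : ∀ u ≠ 0, HasDerivAt k (Complex.I * m u) u) (φ : 𝓢(ℝ, ℂ)) :
    ∫ u, conj (deriv φ u) * k u = -Complex.I * ∫ u, conj (φ u) * m u := by
  set G : ℝ → ℂ := fun u => conj (φ u) * k u
  set G' : ℝ → ℂ := fun u => conj (deriv φ u) * k u + conj (φ u) * (Complex.I * m u)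
  have hφ2 : MemLp φ 2 volume := φ.memLp 2 volume
  have hφ'2 : MemLp (deriv φ) 2 volume := (derivCLM ℂ ℂ φ).memLp 2 volume
  have i1 : Integrable fun u => conj (deriv φ u) * k u := integrable_conj_mul hφ'2 hk
  have i2 : Integrable fun u => conj (φ u) * m u := integrable_conj_mul hφ2 hm
  have i3 : Integrable fun u => conj (φ u) * (Complex.I * m u) := by
    refine (i2.const_mul Complex.I).congr (.of_forall fun u => ?_)
    simp only []; ring
  have hG' : Integrable G' := i1.add i3
  have hG : Integrable G := integrable_conj_mul hφ2 hk
  have hGc : Continuous G := (Complex.continuous_conj.comp φ.continuous).mul hkc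
  have hd : ∀ u ≠ 0, HasDerivAt G (G' u) u := fun u hu => by
    have h1 : HasDerivAt (fun u => conj (φ u)) (conj (deriv φ u)) u := (φ.hasDerivAt u).star
    exact h1.mul (hkd u hu)
  -- Since `G` and `G'` are both integrable, `G` vanishes at infinity. On the left the endpoint `-1`
  -- keeps the closed half-line away from `0`, where `G` need not be differentiable.
  have t1 : Tendsto G atTop (𝓝 0) :=
    tendsto_zero_of_hasDerivAt_of_integrableOn_Ioi (a := 0) (fun u hu => hd u (ne_of_gt hu))
      hG'.integrableOn hG.integrableOn
  have t2 : Tendsto G atBot (𝓝 0) :=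
    tendsto_zero_of_hasDerivAt_of_integrableOn_Iic (a := -1)
      (fun u hu => hd u (ne_of_lt (lt_of_le_of_lt hu (by norm_num))))
      hG'.integrableOn hG.integrableOn
  have e1 := integral_Ioi_of_hasDerivAt_of_tendsto hGc.continuousWithinAt
    (fun u hu => hd u (ne_of_gt hu)) hG'.integrableOn t1
  have e2 := integral_Iic_of_hasDerivAt_of_tendsto hGc.continuousWithinAt
    (fun u hu => hd u (ne_of_lt hu)) hG'.integrableOn t2
  -- The two half-lines contribute `-G 0` and `G 0`; they cancel because `G` is continuous at `0`.
  have e3 : ∫ u, G' u = 0 := by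
    rw [← intervalIntegral.integral_Iic_add_Ioi hG'.integrableOn hG'.integrableOn, e1, e2]
    ring
  have e4 : ∫ u, conj (φ u) * (Complex.I * m u) = Complex.I * ∫ u, conj (φ u) * m u := by
    rw [← integral_const_mul]
    refine integral_congr_ae (.of_forall fun u => ?_)
    simp only []; ring
  rw [integral_add i1 i3, e4] at e3
  linear_combination e3

/-- The graph of `Π_θ` in weak form, after transport to `L²(ℝ, du)`. -/
def weakGraph (θ : ℝ) : Submodule ℂ (L2 × L2) where
  carrier := {p | ∀ φ : 𝓢(ℝ, ℂ), ⟪(derivCLM ℂ ℂ φ).toLp 2, kelvin θ p.1⟫_ℂ =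
    -Complex.I * ⟪φ.toLp 2, kelvin θ p.2⟫_ℂ}
  add_mem' {p q} hp hq φ := by
    simp only [Prod.fst_add, Prod.snd_add, map_add, inner_add_right]
    rw [hp φ, hq φ]; ring
  zero_mem' φ := by simp
  smul_mem' c p hp φ := by
    simp only [Prod.smul_fst, Prod.smul_snd, map_smul, inner_smul_right]
    rw [hp φ]; ring

lemma isClosed_weakGraph (θ : ℝ) : IsClosed (weakGraph θ : Set (L2 × L2)) := by
  have : (weakGraph θ : Set (L2 × L2)) = ⋂ φ : 𝓢(ℝ, ℂ), {p | ⟪(derivCLM ℂ ℂ φ).toLp 2,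
      kelvin θ p.1⟫_ℂ = -Complex.I * ⟪φ.toLp 2, kelvin θ p.2⟫_ℂ} := by
    ext p
    simp only [Set.mem_iInter]
    rfl
  rw [this]
  have hc := (kelvin θ).continuous
  exact isClosed_iInter fun φ => isClosed_eq (by fun_prop) (by fun_prop)

/-- On `weakGraph θ` the diagonalizer turns the operator into multiplication by `2πξ`. -/
lemma diagonalizer_eq_of_mem_weakGraph {θ : ℝ} {p : L2 × L2} (hp : p ∈ weakGraph θ) :
    ∀ᵐ ξ : ℝ, diagonalizer θ p.2 ξ = ((2 * Real.pi * ξ : ℝ) : ℂ) * diagonalizer θ p.1 ξ := by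
  set K := diagonalizer θ p.1
  set M := diagonalizer θ p.2
  have hMl : LocallyIntegrable M volume := (Lp.memLp M).locallyIntegrable (by norm_num)
  have hKl : LocallyIntegrable (fun ξ : ℝ => ((2 * Real.pi * ξ : ℝ) : ℂ) * K ξ) volume :=
    ((Lp.memLp K).locallyIntegrable (by norm_num)).continuous_smul
      (g := fun ξ : ℝ => ((2 * Real.pi * ξ : ℝ) : ℂ)) (by fun_prop)
  refine ae_eq_of_integral_contDiff_smul_eq hMl hKl fun g hg hgc => ?_
  have hg₁ : HasCompactSupport (Complex.ofRealCLM ∘ g) := hgc.comp_left rfl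
  have hg₂ : ContDiff ℝ ∞ (Complex.ofRealCLM ∘ g) := by fun_prop
  set η : 𝓢(ℝ, ℂ) := hg₁.toSchwartzMap hg₂ with hη
  have hηg : ∀ x, η x = g x := fun x => rfl
  -- The test function is prescribed on the Fourier side, so that Plancherel turns the weak identity
  -- into one tested against the arbitrary bump `g`.
  set φ : 𝓢(ℝ, ℂ) := 𝓕⁻ η
  have hFφ : 𝓕 φ = η := FourierTransform.fourier_fourierInv_eq η
  have hFφ' : ∀ ξ : ℝ, (𝓕 (derivCLM ℂ ℂ φ)) ξ = 2 * Real.pi * Complex.I * ξ * η ξ := fun ξ => by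
    rw [← hFφ, fourier_coe, fourier_coe]
    have e : ⇑(derivCLM ℂ ℂ φ) = deriv φ := rfl
    have h := congrFun (Real.fourier_deriv φ.integrable φ.differentiable
      (derivCLM ℂ ℂ φ).integrable) ξ
    rw [e]
    simpa using h
  have h1 : ⟪𝓕 ((derivCLM ℂ ℂ φ).toLp 2 volume), K⟫_ℂ =
      -Complex.I * ⟪𝓕 (φ.toLp 2 volume), M⟫_ℂ :=
    (Lp.inner_fourier_eq _ (kelvin θ p.1)).trans ((hp φ).trans
      (congrArg (-Complex.I * ·) (Lp.inner_fourier_eq _ (kelvin θ p.2)).symm))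
  rw [toLp_fourier_eq, toLp_fourier_eq, hFφ,
    inner_L2_eq_integral (coeFn_toLp _ 2 volume) (ae_eq_refl K),
    inner_L2_eq_integral (coeFn_toLp _ 2 volume) (ae_eq_refl M), ← integral_const_mul] at h1
  have h2 : ∀ ξ : ℝ, conj ((𝓕 (derivCLM ℂ ℂ φ)) ξ) * K ξ =
      -Complex.I * (g ξ • (((2 * Real.pi * ξ : ℝ) : ℂ) * K ξ)) := fun ξ => by
    rw [hFφ', hηg]
    simp only [map_mul, Complex.conj_ofReal, Complex.conj_I, map_ofNat, Complex.real_smul]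
    push_cast
    ring
  have h3 : ∀ ξ : ℝ, -Complex.I * (conj (η ξ) * M ξ) = -Complex.I * (g ξ • M ξ) := fun ξ => by
    rw [hηg, Complex.conj_ofReal, Complex.real_smul]
  simp only [h2, h3, integral_const_mul] at h1
  exact (mul_left_cancel₀ (neg_ne_zero.2 Complex.I_ne_zero) h1).symm

/-- Continuity of `k` is the only condition at `0`; it is the boundary condition that characterizes
the extension. -/
lemma mem_weakGraph_of_hasDerivAt {θ : ℝ} {f g : L2} {k m : ℝ → ℂ}
    (hf : kelvin θ f =ᵐ[volume] k) (hg : kelvin θ g =ᵐ[volume] m) (hkc : Continuous k)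
    (hkd : ∀ u ≠ 0, HasDerivAt k (Complex.I * m u) u) : (f, g) ∈ weakGraph θ := by
  intro φ
  rw [inner_L2_eq_integral (coeFn_toLp _ 2 volume) hf,
    inner_L2_eq_integral (coeFn_toLp _ 2 volume) hg]
  exact integral_conj_deriv_mul_eq ((memLp_congr_ae hf).1 (Lp.memLp _))
    ((memLp_congr_ae hg).1 (Lp.memLp _)) hkc hkd φ

lemma eventually_sign_eq {u : ℝ} (hu : u ≠ 0) : ∀ᶠ v in 𝓝 u, SignType.sign v = SignType.sign u := by
  rcases hu.lt_or_gt with h | h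
  · filter_upwards [Iio_mem_nhds h] with v hv
    rw [sign_neg h, sign_neg hv]
  · filter_upwards [Ioi_mem_nhds h] with v hv
    rw [sign_pos h, sign_pos hv]

lemma hasDerivAt_kelvinFun (θ : ℝ) (ψ : 𝓢(ℝ, ℂ)) {u : ℝ} (hu : u ≠ 0) :
    HasDerivAt (kelvinFun θ ψ) (Complex.I * kelvinFun θ (schwartzPi ψ) u) u := by
  set c := Complex.exp (-(Complex.I * (SignType.sign u : ℝ) * (θ / 2))) with hc
  have hu' : (u : ℂ) ≠ 0 := by exact_mod_cast hu
  have h1 : HasDerivAt (fun v : ℝ => ((v⁻¹ : ℝ) : ℂ)) ((-(u ^ 2)⁻¹ : ℝ) : ℂ) u :=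
    (hasDerivAt_inv hu).ofReal_comp
  have h2 : HasDerivAt (fun v : ℝ => ψ v⁻¹) (-(u ^ 2)⁻¹ • deriv ψ u⁻¹) u :=
    (ψ.hasDerivAt u⁻¹).scomp u (hasDerivAt_inv hu)
  have h3 := (h1.mul_const c).mul h2
  have h4 : HasDerivAt (kelvinFun θ ψ) _ u := h3.congr_of_eventuallyEq (by
    filter_upwards [eventually_sign_eq hu] with v hv
    rw [kelvinFun, invWeight, hv]
    rfl)
  convert h4 using 1
  rw [kelvinFun, invWeight, ← hc, schwartzPi_apply, Complex.real_smul]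
  generalize ψ u⁻¹ = y
  generalize deriv ψ u⁻¹ = y'
  push_cast
  field_simp
  linear_combination (c * (y * u + y')) * Complex.I_sq

/-- At `0`, the decay |ψ(x)| ≤ C/x² gives the bound C|u|, so Schwartz functions are transported to
functions vanishing there. -/
lemma continuous_kelvinFun (θ : ℝ) (ψ : 𝓢(ℝ, ℂ)) : Continuous (kelvinFun θ ψ) := by
  rw [continuous_iff_continuousAt]
  intro u
  rcases eq_or_ne u 0 with rfl | hu
  · obtain ⟨C, hC⟩ := ψ.decay 2 0
    have h0 : kelvinFun θ ψ 0 = 0 := by simp [kelvinFun, invWeight]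
    rw [ContinuousAt, h0]
    refine squeeze_zero_norm (a := fun u => C * |u|) (fun v => ?_) ?_
    · rw [kelvinFun, norm_mul, norm_invWeight]
      rcases eq_or_ne v 0 with rfl | hv
      · simp
      have hv' : 0 < |v| := abs_pos.2 hv
      have h1 := hC.2 v⁻¹
      rw [norm_iteratedFDeriv_zero, Real.norm_eq_abs, abs_inv, inv_pow] at h1
      calc |v|⁻¹ * ‖ψ v⁻¹‖ = |v| * ((|v| ^ 2)⁻¹ * ‖ψ v⁻¹‖) := by field_simp
        _ ≤ |v| * C := by gcongr
        _ = C * |v| := mul_comm _ _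
    · have : Tendsto (fun u : ℝ => C * |u|) (𝓝 0) (𝓝 (C * |(0 : ℝ)|)) :=
        (by fun_prop : Continuous fun u : ℝ => C * |u|).tendsto 0
      simpa using this
  · exact (hasDerivAt_kelvinFun θ ψ hu).continuousAt

lemma schwartz_mem_weakGraph (θ : ℝ) (ψ : 𝓢(ℝ, ℂ)) :
    (ψ.toLp 2 volume, (schwartzPi ψ).toLp 2 volume) ∈ weakGraph θ :=
  mem_weakGraph_of_hasDerivAt
    ((coeFn_kelvin θ _).trans (kelvinFun_congr θ (ψ.coeFn_toLp 2 volume)))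
    ((coeFn_kelvin θ _).trans (kelvinFun_congr θ ((schwartzPi ψ).coeFn_toLp 2 volume)))
    (continuous_kelvinFun θ ψ) fun _ => hasDerivAt_kelvinFun θ ψ

lemma zetaFun_add_pi (θ : ℝ) {x : ℝ} (hx : x ≠ 0) :
    zetaFun (θ + Real.pi) x = Complex.I * (SignType.sign x : ℝ) * zetaFun θ x := by
  have h : Complex.exp (Complex.I * ((SignType.sign x : ℝ) : ℂ) * (((θ + Real.pi : ℝ) : ℂ) / 2)) =
      Complex.exp (Complex.I * ((SignType.sign x : ℝ) : ℂ) * (Real.pi / 2)) *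
      Complex.exp (Complex.I * ((SignType.sign x : ℝ) : ℂ) * (θ / 2)) := by
    rw [← Complex.exp_add]
    congr 1
    push_cast; ring
  have h2 : Complex.exp (Complex.I * ((SignType.sign x : ℝ) : ℂ) * (Real.pi / 2)) =
      Complex.I * ((SignType.sign x : ℝ) : ℂ) := by
    rcases hx.lt_or_gt with h | h
    · rw [sign_neg h]
      have : Complex.I * (((SignType.neg : SignType) : ℝ) : ℂ) * (Real.pi / 2) =
        -(Real.pi / 2 * Complex.I) := by simp; ring
      simp [Complex.exp_neg, mul_comm Complex.I, Complex.exp_pi_div_two_mul_I]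
    · rw [sign_pos h]
      simp [mul_comm Complex.I, Complex.exp_pi_div_two_mul_I]
  rw [zetaFun, zetaFun, h, h2]
  ring

lemma kelvinFun_zetaFun (θ : ℝ) {u : ℝ} (hu : u ≠ 0) :
    kelvinFun θ (zetaFun θ) u = (Real.exp (-|u|) : ℂ) := by
  have hu' : (u : ℂ) ≠ 0 := by exact_mod_cast hu
  have h : Complex.exp (-(Complex.I * ((SignType.sign u : ℝ) : ℂ) * (θ / 2))) *
      Complex.exp (Complex.I * ((SignType.sign u : ℝ) : ℂ) * (θ / 2)) = 1 := by
    rw [← Complex.exp_add, neg_add_cancel, Complex.exp_zero]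
  have h2 : -1 / |u⁻¹| = -|u| := by rw [abs_inv]; simp
  rw [kelvinFun, invWeight, zetaFun, sign_inv_real, inv_inv, h2]
  calc _ = (((u⁻¹ : ℝ) : ℂ) * u) * (Real.exp (-|u|) : ℂ) *
      (Complex.exp (-(Complex.I * ((SignType.sign u : ℝ) : ℂ) * (θ / 2))) *
      Complex.exp (Complex.I * ((SignType.sign u : ℝ) : ℂ) * (θ / 2))) := by push_cast; ring
    _ = _ := by rw [h]; push_cast; field_simp

/-- The phase in `kelvin θ` is the inverse of the phase of ζ_θ: what remains is e^{-|u|}, continuous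
at `0` for every θ. -/
lemma zeta_mem_weakGraph (θ : ℝ) : (zeta θ, zeta (θ + Real.pi)) ∈ weakGraph θ := by
  refine mem_weakGraph_of_hasDerivAt (k := fun u => (Real.exp (-|u|) : ℂ))
    (m := fun u => Complex.I * (SignType.sign u : ℝ) * (Real.exp (-|u|) : ℂ)) ?_ ?_ ?_ ?_
  · refine (coeFn_kelvin θ _).trans
      ((kelvinFun_congr θ (memLp_zetaFun θ).coeFn_toLp).trans ?_)
    filter_upwards [ae_ne_zero_real] with u hu
    exact kelvinFun_zetaFun θ hu
  · refine (coeFn_kelvin θ _).trans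
      ((kelvinFun_congr θ (memLp_zetaFun (θ + Real.pi)).coeFn_toLp).trans ?_)
    filter_upwards [ae_ne_zero_real] with u hu
    rw [kelvinFun, zetaFun_add_pi θ (inv_ne_zero hu), sign_inv_real, ← kelvinFun_zetaFun θ hu,
      kelvinFun]
    ring
  · fun_prop
  · intro u hu
    have h1 : HasDerivAt (fun v : ℝ => Real.exp (-|v|))
        (Real.exp (-|u|) * -(SignType.sign u : ℝ)) u := ((hasDerivAt_abs hu).neg).exp
    convert h1.ofReal_comp using 1
    push_cast
    linear_combination (((SignType.sign u : ℝ) : ℂ) * Complex.exp (-|u|)) * Complex.I_sq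

end WeakGraph

/-! ### Self-adjointness: Π_θ is all of the multiplication operator. -/

section ThermalGraph

open Filter Topology
open scoped ContDiff ComplexConjugate

/-- The graph of `Π_θ`. -/
def thermalGraph (θ : ℝ) : Submodule ℂ (L2 × L2) :=
  schwartzPiGraph.topologicalClosure ⊔ Submodule.span ℂ {(zeta θ, zeta (θ + Real.pi))}

lemma thermalGraph_le_weakGraph (θ : ℝ) : thermalGraph θ ≤ weakGraph θ := by
  refine sup_le (Submodule.topologicalClosure_minimal _ ?_ (isClosed_weakGraph θ)) ?_
  · rintro _ ⟨ψ, rfl⟩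
    exact schwartz_mem_weakGraph θ ψ
  · rw [Submodule.span_singleton_le_iff_mem]
    exact zeta_mem_weakGraph θ

lemma isClosed_thermalGraph (θ : ℝ) : IsClosed (thermalGraph θ : Set (L2 × L2)) :=
  Submodule.isClosed_sup_finiteDimensional _ _ (Submodule.isClosed_topologicalClosure _)

lemma schwartz_mem_thermalGraph (θ : ℝ) (ψ : 𝓢(ℝ, ℂ)) :
    (ψ.toLp 2 volume, (schwartzPi ψ).toLp 2 volume) ∈ thermalGraph θ :=
  (le_sup_left : _ ≤ thermalGraph θ) (Submodule.le_topologicalClosure _ ⟨ψ, rfl⟩)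

lemma zeta_mem_thermalGraph (θ : ℝ) : (zeta θ, zeta (θ + Real.pi)) ∈ thermalGraph θ :=
  (le_sup_right : _ ≤ thermalGraph θ) (Submodule.mem_span_singleton_self _)

lemma inner_eq_conj_of_diagonalizer_eq {θ : ℝ} {p : L2 × L2} (h : ∀ᵐ ξ : ℝ,
    diagonalizer θ p.2 ξ = ((2 * Real.pi * ξ : ℝ) : ℂ) * diagonalizer θ p.1 ξ) :
    ⟪p.1, p.2⟫_ℂ = ⟪p.2, p.1⟫_ℂ := by
  rw [← (diagonalizer θ).inner_map_map p.1, ← (diagonalizer θ).inner_map_map p.2,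
    inner_L2_eq_integral (ae_eq_refl _) h, inner_L2_eq_integral h (ae_eq_refl _)]
  refine integral_congr_ae (.of_forall fun ξ => ?_)
  simp only [map_mul, Complex.conj_ofReal]
  ring

/-- Symmetry removes the cross term. The identity yields both the closed range of Π_θ + i and the
injectivity of the multiplication operator plus i. -/
lemma norm_sq_add_I_smul {θ : ℝ} {p : L2 × L2} (hp : ∀ᵐ ξ : ℝ,
    diagonalizer θ p.2 ξ = ((2 * Real.pi * ξ : ℝ) : ℂ) * diagonalizer θ p.1 ξ) :
    ‖p.2 + Complex.I • p.1‖ ^ 2 = ‖p.2‖ ^ 2 + ‖p.1‖ ^ 2 := by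
  have h1 : RCLike.re ⟪p.2, Complex.I • p.1⟫_ℂ = 0 := by
    have h := inner_eq_conj_of_diagonalizer_eq hp
    rw [← inner_conj_symm] at h
    rw [inner_smul_right]
    have := Complex.conj_eq_iff_im.1 h
    simp [this]
  rw [@norm_add_sq ℂ, h1, norm_smul]
  simp

/-- Testing against `ψ = x⁻¹ e^{1/x} χ`, for which `(Π + i) ψ = i x e^{1/x} χ'`. -/
lemma exists_schwartz_add_I_smul {χ : ℝ → ℝ} (hχ : ContDiff ℝ ∞ χ) (hc : HasCompactSupport χ)
    (h0 : tsupport χ ⊆ {0}ᶜ) :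
    ∃ ψ : 𝓢(ℝ, ℂ), ∀ x : ℝ, schwartzPi ψ x + Complex.I * ψ x =
      Complex.I * ((x * Real.exp x⁻¹ * deriv χ x : ℝ) : ℂ) := by
  set g : ℝ → ℝ := fun x => x⁻¹ * Real.exp x⁻¹ * χ x with hg
  have hgs : ContDiff ℝ ∞ g := by
    rw [contDiff_iff_contDiffAt]
    intro x
    by_cases hx : x ∈ tsupport χ
    · have hx0 : x ≠ 0 := h0 hx
      have hi : ContDiffAt ℝ ∞ (fun x : ℝ => x⁻¹) x := contDiffAt_inv ℝ hx0
      exact (hi.mul hi.exp).mul hχ.contDiffAt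
    · refine contDiffAt_const (c := (0 : ℝ)) |>.congr_of_eventuallyEq ?_
      filter_upwards [notMem_tsupport_iff_eventuallyEq.1 hx] with y hy
      simp [hg, hy]
  have hgc : HasCompactSupport g := hc.mul_left
  have hg₁ : HasCompactSupport (Complex.ofRealCLM ∘ g) := hgc.comp_left rfl
  have hg₂ : ContDiff ℝ ∞ (Complex.ofRealCLM ∘ g) := by fun_prop
  refine ⟨hg₁.toSchwartzMap hg₂, fun x => ?_⟩
  have hψ : ∀ x, hg₁.toSchwartzMap hg₂ x = (g x : ℂ) := fun x => rfl
  rw [schwartzPi_apply]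
  rcases eq_or_ne x 0 with rfl | hx
  · simp [hψ, hg]
  have hx' : (x : ℂ) ≠ 0 := by exact_mod_cast hx
  have d1 : HasDerivAt g _ x := ((hasDerivAt_inv hx).mul (hasDerivAt_inv hx).exp).mul
    (hχ.differentiable (by simp) x).hasDerivAt
  have d2 : deriv (hg₁.toSchwartzMap hg₂) x = _ := d1.ofReal_comp.deriv
  rw [d2, hψ, hg]
  push_cast
  generalize deriv χ x = y'
  generalize χ x = y
  simp only [Pi.mul_apply, Complex.ofReal_mul, Complex.ofReal_exp, Complex.ofReal_inv]
  generalize Complex.exp (x : ℂ)⁻¹ = e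
  field_simp
  ring

/-- Tested on x⁻¹ e^{1/x} χ, orthogonality to the range of Π + i is the weak equation (x e^{1/x} h)'
= 0 on intervals avoiding `0`. -/
lemma ae_const_of_orthogonal {θ : ℝ} {h : L2}
    (hh : ∀ p ∈ thermalGraph θ, ⟪p.2 + Complex.I • p.1, h⟫_ℂ = 0) {U : Set ℝ} (hU : IsOpen U)
    (hc : U.OrdConnected) (h0 : U ⊆ {0}ᶜ) :
    ∃ c : ℂ, ∀ᵐ x : ℝ, x ∈ U → (x * Real.exp x⁻¹ : ℝ) • h x = c := by
  have hloc : LocallyIntegrableOn (fun x : ℝ => (x * Real.exp x⁻¹ : ℝ) • h x) U := by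
    refine LocallyIntegrableOn.continuousOn_smul hU.isLocallyClosed
      (((Lp.memLp h).locallyIntegrable (by norm_num)).locallyIntegrableOn U) ?_
    have hi : ContinuousOn (fun x : ℝ => x⁻¹) U := continuousOn_inv₀.mono h0
    exact continuousOn_id.mul hi.rexp
  refine ae_eq_const_of_integral_deriv_smul_eq_zero hU hc hloc fun χ hχ hχc hχU => ?_
  obtain ⟨ψ, hψ⟩ := exists_schwartz_add_I_smul hχ hχc (hχU.trans h0)
  have h1 := hh _ (schwartz_mem_thermalGraph θ ψ)
  have h2 : ((schwartzPi ψ).toLp 2 volume + Complex.I • ψ.toLp 2 volume : L2) =ᵐ[volume]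
      fun x : ℝ => Complex.I * ((x * Real.exp x⁻¹ * deriv χ x : ℝ) : ℂ) := by
    filter_upwards [Lp.coeFn_add ((schwartzPi ψ).toLp 2 volume) (Complex.I • ψ.toLp 2 volume),
      Lp.coeFn_smul Complex.I (ψ.toLp 2 volume), ψ.coeFn_toLp 2 volume,
      (schwartzPi ψ).coeFn_toLp 2 volume] with x e1 e2 e3 e4
    rw [e1, Pi.add_apply, e2, Pi.smul_apply, e3, e4, smul_eq_mul, hψ]
  rw [inner_L2_eq_integral h2 (ae_eq_refl h)] at h1
  have h3 : ∀ x : ℝ, conj (Complex.I * ((x * Real.exp x⁻¹ * deriv χ x : ℝ) : ℂ)) * h x =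
      -Complex.I * (deriv χ x • ((x * Real.exp x⁻¹ : ℝ) • h x)) := fun x => by
    rw [map_mul, Complex.conj_ofReal, Complex.conj_I, Complex.real_smul, Complex.real_smul]
    push_cast
    ring
  simp only [h3, integral_const_mul] at h1
  exact (mul_eq_zero.1 h1).resolve_left (neg_ne_zero.2 Complex.I_ne_zero)

/-- For x < 0 one has e^{1/x} ≤ 1, so |h| ≥ |c|/|x|; with c ≠ 0, square integrability of h would
make 1/x integrable up to `0`. -/
lemma eq_zero_of_ae_Iio {h : L2} {c : ℂ}
    (hc : ∀ᵐ x : ℝ, x ∈ Set.Iio 0 → (x * Real.exp x⁻¹ : ℝ) • h x = c) : c = 0 := by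
  by_contra hc0
  have hcn : 0 < ‖c‖ := norm_pos_iff.2 hc0
  have h1 : Integrable fun x => ‖h x‖ ^ 2 := (Lp.memLp h).integrable_norm_pow two_ne_zero
  have h2 : IntegrableOn (fun x : ℝ => x⁻¹) (Set.Ioc (-1) 0) := by
    refine ((h1.const_mul (‖c‖ ^ 2)⁻¹).integrableOn (s := Set.Ioc (-1) 0)).mono'
      measurable_inv.aestronglyMeasurable ?_
    filter_upwards [ae_restrict_mem measurableSet_Ioc, ae_restrict_of_ae hc,
      ae_restrict_of_ae ae_ne_zero_real] with x hx hxc hx0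
    have hneg : x < 0 := lt_of_le_of_ne hx.2 hx0
    have hpos : 0 < |x| := abs_pos.2 hx0
    have hle : |x| ≤ 1 := abs_le.2 ⟨hx.1.le, by linarith⟩
    have he : Real.exp x⁻¹ ≤ 1 := Real.exp_le_one_iff.2 (inv_nonpos.2 hneg.le)
    have hn : ‖c‖ ≤ |x| * ‖h x‖ := by
      rw [← hxc hneg, norm_smul, norm_mul, Real.norm_eq_abs, Real.norm_eq_abs, Real.abs_exp]
      calc |x| * Real.exp x⁻¹ * ‖h x‖ ≤ |x| * 1 * ‖h x‖ := by gcongr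
        _ = |x| * ‖h x‖ := by ring
    rw [Real.norm_eq_abs, abs_inv, ← div_eq_inv_mul, inv_eq_one_div,
      div_le_div_iff₀ hpos (by positivity)]
    calc 1 * ‖c‖ ^ 2 ≤ (|x| * ‖h x‖) ^ 2 := by rw [one_mul]; gcongr
      _ = |x| * (‖h x‖ ^ 2 * |x|) := by ring
      _ ≤ 1 * (‖h x‖ ^ 2 * |x|) := by gcongr
      _ = ‖h x‖ ^ 2 * |x| := one_mul _
  have h3 : IntervalIntegrable (fun x : ℝ => x⁻¹) volume (-1) 0 :=
    (intervalIntegrable_iff_integrableOn_Ioc_of_le (by norm_num)).2 h2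
  rw [intervalIntegrable_inv_iff] at h3
  rcases h3 with h3 | h3
  · norm_num at h3
  · exact h3 Set.right_mem_uIcc

/-- The negative half-line is excluded by integrability, but x⁻¹ e^{-1/x} on the positive one is in
L² and is eliminated by the adjoined vector. Indeed (Π_θ + i) ζ_θ = i (sgn x + 1) ζ_θ is supported
on x > 0 and `h` is a multiple of it, so `h` is orthogonal to itself. -/
lemma eq_zero_of_orthogonal {θ : ℝ} {h : L2}
    (hh : ∀ p ∈ thermalGraph θ, ⟪p.2 + Complex.I • p.1, h⟫_ℂ = 0) : h = 0 := by
  obtain ⟨c, hc⟩ := ae_const_of_orthogonal hh isOpen_Ioi Set.ordConnected_Ioi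
    (fun x (hx : 0 < x) => ne_of_gt hx)
  obtain ⟨d, hd⟩ := ae_const_of_orthogonal hh isOpen_Iio Set.ordConnected_Iio
    (fun x (hx : x < 0) => ne_of_lt hx)
  obtain rfl := eq_zero_of_ae_Iio hd
  set w : L2 := zeta (θ + Real.pi) + Complex.I • zeta θ with hw
  -- For x > 0, `w` equals 2i e^{iθ/2} x⁻¹ e^{-1/x}, while `h` equals c x⁻¹ e^{-1/x}.
  set c' : ℂ := c / (2 * Complex.I * Complex.exp (Complex.I * (θ / 2)))
  have key : h = c' • w := by
    refine Lp.ext ?_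
    filter_upwards [hc, hd, ae_ne_zero_real, Lp.coeFn_smul c' w,
      Lp.coeFn_add (zeta (θ + Real.pi)) (Complex.I • zeta θ), Lp.coeFn_smul Complex.I (zeta θ),
      (memLp_zetaFun θ).coeFn_toLp, (memLp_zetaFun (θ + Real.pi)).coeFn_toLp]
      with x h1 h2 hx e1 e2 e3 e4 e5
    have e4' : zeta θ x = zetaFun θ x := e4
    have e5' : zeta (θ + Real.pi) x = zetaFun (θ + Real.pi) x := e5
    rw [e1, Pi.smul_apply, hw, e2, Pi.add_apply, e3, Pi.smul_apply, e4', e5', zetaFun_add_pi θ hx]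
    rcases hx.lt_or_gt with hneg | hpos
    · have h3 : h x = 0 := (smul_eq_zero.1 (h2 hneg)).resolve_left
        (mul_ne_zero hx (Real.exp_ne_zero _))
      rw [h3, sign_neg hneg]
      simp
    · have h3 := h1 hpos
      have hx' : (x : ℂ) ≠ 0 := by exact_mod_cast hx
      have hE : (Real.exp (-1 / |x|) : ℂ) * Real.exp x⁻¹ = 1 := by
        rw [abs_of_pos hpos, ← Complex.ofReal_mul, ← Real.exp_add]
        have : -1 / x + x⁻¹ = 0 := by ring
        rw [this]; simp
      have hI := Complex.exp_ne_zero (Complex.I * (θ / 2))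
      rw [Complex.real_smul] at h3
      rw [zetaFun, sign_pos hpos]
      simp only [c', ← h3, smul_eq_mul, SignType.coe_one, Complex.ofReal_one, mul_one,
        Complex.ofReal_mul, Complex.ofReal_inv]
      generalize Complex.exp (Complex.I * (θ / 2)) = t at *
      generalize (Real.exp x⁻¹ : ℂ) = s at *
      generalize (Real.exp (-1 / |x|) : ℂ) = s' at *
      field_simp
      linear_combination (-2 * h x) * hE
  have h1 : ⟪w, h⟫_ℂ = 0 := hh _ (zeta_mem_thermalGraph θ)
  rw [← inner_self_eq_zero (𝕜 := ℂ)]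
  conv_lhs => rw [key, inner_smul_left, ← key, h1, mul_zero]

lemma exists_mem_thermalGraph (θ : ℝ) (y : L2) :
    ∃ p ∈ thermalGraph θ, p.2 + Complex.I • p.1 = y := by
  have : CompleteSpace (thermalGraph θ) := (isClosed_thermalGraph θ).completeSpace_coe
  let L : thermalGraph θ →L[ℂ] L2 := (ContinuousLinearMap.snd ℂ L2 L2 +
    Complex.I • ContinuousLinearMap.fst ℂ L2 L2).comp (thermalGraph θ).subtypeL
  have hL : ∀ p : thermalGraph θ, L p = (p : L2 × L2).2 + Complex.I • (p : L2 × L2).1 :=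
    fun p => rfl
  have hanti : AntilipschitzWith 1 L := L.antilipschitz_of_bound fun p => by
    have h := norm_sq_add_I_smul
      (diagonalizer_eq_of_mem_weakGraph (thermalGraph_le_weakGraph θ p.2))
    rw [NNReal.coe_one, one_mul, hL, Submodule.coe_norm, Prod.norm_def]
    refine max_le ?_ ?_ <;> refine (sq_le_sq₀ (norm_nonneg _) (norm_nonneg _)).1 ?_ <;>
      rw [h] <;> simp
  have hcl : IsClosed (L.range : Set L2) := hanti.isClosed_range L.uniformContinuous
  have : CompleteSpace L.range := hcl.completeSpace_coe
  have htop : L.range = ⊤ := by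
    rw [← Submodule.orthogonal_eq_bot_iff, Submodule.eq_bot_iff]
    intro h hh
    exact eq_zero_of_orthogonal (θ := θ) fun p hp => hh _ ⟨⟨p, hp⟩, rfl⟩
  obtain ⟨p, hp⟩ : y ∈ L.range := htop ▸ Submodule.mem_top
  exact ⟨p, p.2, hp⟩

/-- `Π_θ` is the operator that the diagonalizer turns into multiplication by `2πξ`. -/
theorem mem_thermalGraph_iff {θ : ℝ} {p : L2 × L2} : p ∈ thermalGraph θ ↔
    ∀ᵐ ξ : ℝ, diagonalizer θ p.2 ξ = ((2 * Real.pi * ξ : ℝ) : ℂ) * diagonalizer θ p.1 ξ := by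
  refine ⟨fun hp => diagonalizer_eq_of_mem_weakGraph (thermalGraph_le_weakGraph θ hp),
    fun hp => ?_⟩
  -- Surjectivity of Π_θ + i gives `q` in the graph with the same image as `p`; then `q - p` is
  -- annihilated by the multiplication operator plus i, hence is zero.
  obtain ⟨q, hq, hqp⟩ := exists_mem_thermalGraph θ (p.2 + Complex.I • p.1)
  have h0 := diagonalizer_eq_of_mem_weakGraph (thermalGraph_le_weakGraph θ hq)
  have h1 : ∀ᵐ ξ : ℝ, diagonalizer θ (q - p).2 ξ =
      ((2 * Real.pi * ξ : ℝ) : ℂ) * diagonalizer θ (q - p).1 ξ := by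
    rw [Prod.fst_sub, Prod.snd_sub, map_sub, map_sub]
    filter_upwards [hp, h0, Lp.coeFn_sub (diagonalizer θ q.2) (diagonalizer θ p.2),
      Lp.coeFn_sub (diagonalizer θ q.1) (diagonalizer θ p.1)] with ξ a1 a2 a3 a4
    rw [a3, a4, Pi.sub_apply, Pi.sub_apply, a1, a2]
    ring
  have h2 := norm_sq_add_I_smul h1
  have h3 : (q - p).2 + Complex.I • (q - p).1 = 0 := by
    rw [Prod.fst_sub, Prod.snd_sub, smul_sub, sub_add_sub_comm, hqp, sub_self]
  rw [h3, norm_zero] at h2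
  have h4 : ‖(q - p).2‖ = 0 := by nlinarith [norm_nonneg (q - p).2, norm_nonneg (q - p).1]
  have h5 : ‖(q - p).1‖ = 0 := by nlinarith [norm_nonneg (q - p).2, norm_nonneg (q - p).1]
  have h6 : q - p = 0 := Prod.ext (norm_eq_zero.1 h5) (norm_eq_zero.1 h4)
  rwa [← sub_eq_zero.1 h6]

end ThermalGraph

/-! ### The spectral measure of Π_θ. -/

section SpectralMeasure

open Filter Topology
open scoped ComplexConjugate NNReal

section Restriction

variable {S T : Set ℝ} (hS : MeasurableSet S) (hT : MeasurableSet T)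

lemma coeFn_restrictionProj (f : L2) : restrictionProj S hS f =ᵐ[volume] S.indicator f :=
  ((Lp.memLp f).indicator hS).coeFn_toLp

lemma restrictionProj_restrictionProj (f : L2) :
    restrictionProj S hS (restrictionProj T hT f) = restrictionProj (S ∩ T) (hS.inter hT) f := by
  refine Lp.ext ?_
  filter_upwards [coeFn_restrictionProj hS (restrictionProj T hT f), coeFn_restrictionProj hT f,
    coeFn_restrictionProj (hS.inter hT) f] with x h1 h2 h3
  rw [h1, h3, ← Set.indicator_indicator]
  by_cases hx : x ∈ S
  · rw [Set.indicator_of_mem hx, Set.indicator_of_mem hx, h2]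
  · rw [Set.indicator_of_notMem hx, Set.indicator_of_notMem hx]

lemma restrictionProj_eq_zero (hSe : volume S = 0) (f : L2) : restrictionProj S hS f = 0 := by
  refine Lp.ext ?_
  have h : ∀ᵐ x : ℝ, x ∉ S := by simpa [ae_iff] using hSe
  filter_upwards [coeFn_restrictionProj hS f, Lp.coeFn_zero ℂ 2 (volume : Measure ℝ), h]
    with x h1 h2 hx
  rw [h1, h2, Set.indicator_of_notMem hx]
  rfl

lemma restrictionProj_univ (f : L2) : restrictionProj Set.univ MeasurableSet.univ f = f := by
  refine Lp.ext ((coeFn_restrictionProj MeasurableSet.univ f).trans ?_)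
  rw [Set.indicator_univ]

lemma inner_restrictionProj_left (f g : L2) :
    ⟪restrictionProj S hS f, g⟫_ℂ = ⟪f, restrictionProj S hS g⟫_ℂ := by
  rw [inner_L2_eq_integral (coeFn_restrictionProj hS f) (ae_eq_refl _),
    inner_L2_eq_integral (ae_eq_refl _) (coeFn_restrictionProj hS g)]
  refine integral_congr_ae (.of_forall fun x => ?_)
  by_cases hx : x ∈ S <;> simp [hx]

lemma ofReal_norm_sq_restrictionProj (f : L2) :
    ENNReal.ofReal (‖restrictionProj S hS f‖ ^ 2) = ∫⁻ x in S, ((‖f x‖₊ ^ 2 : ℝ≥0) : ℝ≥0∞) := by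
  have h1 : ‖restrictionProj S hS f‖ ^ 2 = ∫ x in S, ‖f x‖ ^ 2 := by
    rw [← integral_indicator hS]
    have h := inner_L2_eq_integral (coeFn_restrictionProj hS f) (coeFn_restrictionProj hS f)
    rw [inner_self_eq_norm_sq_to_K] at h
    have h2 : ∀ x, conj (S.indicator f x) * S.indicator f x =
        ((S.indicator (fun x => ‖f x‖ ^ 2) x : ℝ) : ℂ) := fun x => by
      by_cases hx : x ∈ S
      · simp [hx, Complex.conj_mul']
      · simp [hx]
    simp only [h2] at h
    rw [integral_complex_ofReal] at h
    exact Complex.ofReal_injective ((Complex.ofReal_pow _ _).trans h)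
  rw [h1, ofReal_integral_eq_lintegral_ofReal
    ((Lp.memLp f).integrable_norm_pow two_ne_zero).integrableOn
    (.of_forall fun x => by positivity)]
  refine lintegral_congr fun x => ?_
  rw [ENNReal.ofReal_pow (norm_nonneg _), ofReal_norm]
  simp [enorm]

/-- Orthogonality gives ‖u - ∑ v i‖² = ‖u‖² - ∑ ‖v i‖² for finite sums, and countable additivity of
∫ |f|² sends the right side to zero. -/
lemma hasSum_restrictionProj (B : ℕ → Set ℝ) (hB : ∀ i, MeasurableSet (B i))
    (hd : Pairwise (Function.onFun Disjoint B)) (f : L2) :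
    HasSum (fun i => restrictionProj (B i) (hB i) f)
      (restrictionProj (⋃ i, B i) (MeasurableSet.iUnion hB) f) := by
  set u := restrictionProj (⋃ i, B i) (MeasurableSet.iUnion hB) f
  set v := fun i => restrictionProj (B i) (hB i) f
  have hvv : ∀ i j, i ≠ j → ⟪v i, v j⟫_ℂ = 0 := fun i j hij => by
    rw [inner_restrictionProj_left, restrictionProj_restrictionProj,
      restrictionProj_eq_zero _ (by rw [(hd hij).inter_eq, measure_empty]), inner_zero_right]
  have huv : ∀ i, ⟪u, v i⟫_ℂ = (‖v i‖ : ℂ) ^ 2 := fun i => by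
    have h1 : restrictionProj (⋃ i, B i) (MeasurableSet.iUnion hB) (v i) = v i := by
      rw [restrictionProj_restrictionProj]
      congr 1
      congr 1
      exact Set.inter_eq_right.2 (Set.subset_iUnion B i)
    have h2 : restrictionProj (B i) (hB i) (v i) = v i := by
      rw [restrictionProj_restrictionProj]
      congr 1
      congr 1
      exact Set.inter_self _
    rw [inner_restrictionProj_left, h1, ← h2, ← inner_restrictionProj_left, h2]
    exact inner_self_eq_norm_sq_to_K _
  have hF : ∀ s : Finset ℕ, ‖u - ∑ i ∈ s, v i‖ ^ 2 = ‖u‖ ^ 2 - ∑ i ∈ s, ‖v i‖ ^ 2 := by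
    intro s
    induction s using Finset.induction_on with
    | empty => simp
    | insert i s hi ih =>
      have h1 : ⟪u - ∑ j ∈ s, v j, v i⟫_ℂ = (‖v i‖ : ℂ) ^ 2 := by
        rw [inner_sub_left, sum_inner, huv, Finset.sum_eq_zero, sub_zero]
        exact fun j hj => hvv j i fun h => hi (h ▸ hj)
      have h2 : (RCLike.re ⟪u - ∑ j ∈ s, v j, v i⟫_ℂ : ℝ) = ‖v i‖ ^ 2 := by
        rw [h1, ← Complex.ofReal_pow]
        exact Complex.ofReal_re _
      rw [Finset.sum_insert hi, Finset.sum_insert hi, add_comm, ← sub_sub, @norm_sub_sq ℂ, h2, ih]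
      ring
  have hsum : HasSum (fun i => ‖v i‖ ^ 2) (‖u‖ ^ 2) := by
    have h1 : ∑' i, ENNReal.ofReal (‖v i‖ ^ 2) = ENNReal.ofReal (‖u‖ ^ 2) := by
      rw [ofReal_norm_sq_restrictionProj, lintegral_iUnion hB hd]
      exact tsum_congr fun i => ofReal_norm_sq_restrictionProj _ _
    have h3 := ENNReal.hasSum_toReal (f := fun i => ENNReal.ofReal (‖v i‖ ^ 2))
      (by rw [h1]; exact ENNReal.ofReal_ne_top)
    rw [← ENNReal.tsum_toReal_eq fun i => ENNReal.ofReal_ne_top, h1] at h3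
    simp only [ENNReal.toReal_ofReal (sq_nonneg _)] at h3
    exact h3
  rw [HasSum, tendsto_iff_norm_sub_tendsto_zero]
  have h1 : Tendsto (fun s : Finset ℕ => ‖u‖ ^ 2 - ∑ i ∈ s, ‖v i‖ ^ 2) atTop
      (𝓝 (‖u‖ ^ 2 - ‖u‖ ^ 2)) := tendsto_const_nhds.sub hsum
  have h2 := h1.sqrt
  simp only [← hF, sub_self, Real.sqrt_zero, Real.sqrt_sq (norm_nonneg _)] at h2
  refine h2.congr fun s => norm_sub_rev _ _

end Restriction

/-- The frequencies `ξ` with `2πξ ∈ B`. -/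
def momentumSet (B : Set ℝ) : Set ℝ := (fun ξ => 2 * Real.pi * ξ) ⁻¹' B

lemma measurableSet_momentumSet {B : Set ℝ} (hB : MeasurableSet B) :
    MeasurableSet (momentumSet B) :=
  hB.preimage (by fun_prop)

/-- Multiplication by the indicator function of `momentumSet B`, conjugated by the diagonalizer. -/
def momentumProj (θ : ℝ) (B : Set ℝ) (hB : MeasurableSet B) : L2 →L[ℂ] L2 :=
  (diagonalizer θ).symm.toContinuousLinearEquiv.toContinuousLinearMap ∘L
    restrictionProj (momentumSet B) (measurableSet_momentumSet hB) ∘L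
    (diagonalizer θ).toContinuousLinearEquiv.toContinuousLinearMap

lemma diagonalizer_momentumProj (θ : ℝ) {B : Set ℝ} (hB : MeasurableSet B) (f : L2) :
    diagonalizer θ (momentumProj θ B hB f) =
      restrictionProj (momentumSet B) (measurableSet_momentumSet hB) (diagonalizer θ f) :=
  (diagonalizer θ).apply_symm_apply _

open Classical in
/-- The spectral measure of `Π_θ`. -/
def momentumMeasure (θ : ℝ) : ProjectionMeasure L2 where
  proj B := if h : MeasurableSet B then momentumProj θ B h else 0
  isStarProjection B hB := by
    rw [dif_pos hB]
    refine ⟨?_, ?_⟩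
    · ext1 f
      refine (diagonalizer θ).injective ?_
      rw [mul_apply_eq_comp, diagonalizer_momentumProj, diagonalizer_momentumProj,
        restrictionProj_restrictionProj]
      congr 2
      exact Set.inter_self _
    · rw [ContinuousLinearMap.isSelfAdjoint_iff_isSymmetric]
      intro f g
      change ⟪momentumProj θ B hB f, g⟫_ℂ = ⟪f, momentumProj θ B hB g⟫_ℂ
      rw [← (diagonalizer θ).inner_map_map, ← (diagonalizer θ).inner_map_map f,
        diagonalizer_momentumProj, diagonalizer_momentumProj, inner_restrictionProj_left]
  univ := by
    rw [dif_pos MeasurableSet.univ]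
    ext1 f
    refine (diagonalizer θ).injective ?_
    rw [diagonalizer_momentumProj]
    exact restrictionProj_univ _
  hasSum_iUnion B hB hd f := by
    rw [dif_pos (MeasurableSet.iUnion hB)]
    simp only [dif_pos (hB _)]
    have h := hasSum_restrictionProj (fun i => momentumSet (B i))
      (fun i => measurableSet_momentumSet (hB i)) (fun i j hij => (hd hij).preimage _)
      (diagonalizer θ f)
    have h2 := h.mapL (diagonalizer θ).symm.toContinuousLinearEquiv.toContinuousLinearMap
    have e : momentumProj θ (⋃ i, B i) (MeasurableSet.iUnion hB) f = (diagonalizer θ).symm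
        (restrictionProj (⋃ i, momentumSet (B i))
          (MeasurableSet.iUnion fun i => measurableSet_momentumSet (hB i)) (diagonalizer θ f)) := by
      simp only [momentumProj, momentumSet, Set.preimage_iUnion]
      rfl
    rw [e]
    exact h2

lemma momentumMeasure_proj (θ : ℝ) {B : Set ℝ} (hB : MeasurableSet B) :
    (momentumMeasure θ).proj B = momentumProj θ B hB :=
  dif_pos hB

lemma aemeasurable_nnnorm_sq (f : L2) : AEMeasurable (fun x => ‖f x‖₊ ^ 2) volume :=
  (Lp.aestronglyMeasurable f).aemeasurable.nnnorm.pow_const 2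

lemma scalarMeasure_momentumMeasure (θ : ℝ) (ψ : L2) :
    (momentumMeasure θ).scalarMeasure ψ = ((volume : Measure ℝ).withDensity
      fun ξ => ((‖diagonalizer θ ψ ξ‖₊ ^ 2 : ℝ≥0) : ℝ≥0∞)).map (fun ξ => 2 * Real.pi * ξ) := by
  ext B hB
  rw [Measure.map_apply (by fun_prop) hB, withDensity_apply _ (hB.preimage (by fun_prop)),
    ProjectionMeasure.scalarMeasure_apply _ _ hB, momentumMeasure_proj θ hB,
    ← (diagonalizer θ).norm_map, diagonalizer_momentumProj]
  exact ofReal_norm_sq_restrictionProj _ _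

/-- `toLinearPMap` has the given submodule as its graph once that submodule is single-valued, which
the multiplication form guarantees. -/
lemma thermalPi_graph (θ : ℝ) : (thermalPi θ).graph = thermalGraph θ := by
  refine Submodule.toLinearPMap_graph_eq (thermalGraph θ) fun p hp h0 => ?_
  have h := mem_thermalGraph_iff.1 hp
  rw [h0, map_zero] at h
  rw [← (diagonalizer θ).map_eq_zero_iff]
  refine Lp.ext ?_
  filter_upwards [h, Lp.coeFn_zero ℂ 2 (volume : Measure ℝ)] with ξ h1 h2
  rw [h1, h2, Pi.zero_apply, mul_zero]

lemma mem_thermalPi_domain_iff {θ : ℝ} {ψ : L2} : ψ ∈ (thermalPi θ).domain ↔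
    MemLp (fun ξ : ℝ => ((2 * Real.pi * ξ : ℝ) : ℂ) * diagonalizer θ ψ ξ) 2 volume := by
  rw [LinearPMap.mem_domain_iff]
  simp only [thermalPi_graph, mem_thermalGraph_iff]
  constructor
  · rintro ⟨y, hy⟩
    exact (memLp_congr_ae hy).1 (Lp.memLp _)
  · intro h
    refine ⟨(diagonalizer θ).symm (h.toLp _), ?_⟩
    rw [LinearIsometryEquiv.apply_symm_apply]
    exact h.coeFn_toLp

/-- The scalar measure of ψ is the image under ξ ↦ 2πξ of |`diagonalizer θ ψ`|² dξ, so both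
conditions become integrals for multiplication by 2πξ. -/
theorem momentumMeasure_represents (θ : ℝ) : (momentumMeasure θ).Represents (thermalPi θ) := by
  have hm : Measurable fun ξ : ℝ => 2 * Real.pi * ξ := by fun_prop
  constructor
  · intro ψ
    rw [mem_thermalPi_domain_iff, scalarMeasure_momentumMeasure,
      integrable_map_measure (by fun_prop) hm.aemeasurable,
      integrable_withDensity_iff_integrable_smul₀ (aemeasurable_nnnorm_sq _),
      memLp_two_iff_integrable_sq_norm]
    · refine integrable_congr (.of_forall fun ξ => ?_)
      simp only [norm_mul, Complex.norm_real, Real.norm_eq_abs, mul_pow, sq_abs,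
        Function.comp_apply, NNReal.smul_def, smul_eq_mul, NNReal.coe_pow, coe_nnnorm]
      ring
    · exact (by fun_prop : Continuous fun ξ : ℝ =>
        ((2 * Real.pi * ξ : ℝ) : ℂ)).aestronglyMeasurable.mul (Lp.aestronglyMeasurable _)
  · intro ψ
    have hg : ((ψ : L2), thermalPi θ ψ) ∈ thermalGraph θ := by
      rw [← thermalPi_graph]
      exact (thermalPi θ).mem_graph ψ
    rw [← (diagonalizer θ).inner_map_map,
      inner_L2_eq_integral (ae_eq_refl _) (mem_thermalGraph_iff.1 hg),
      scalarMeasure_momentumMeasure, integral_map hm.aemeasurable (by fun_prop),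
      integral_withDensity_eq_integral_smul₀ (aemeasurable_nnnorm_sq _),
      ← integral_complex_ofReal]
    refine integral_congr_ae (.of_forall fun ξ => ?_)
    simp only [NNReal.smul_def, smul_eq_mul, NNReal.coe_pow, coe_nnnorm]
    push_cast
    linear_combination (2 * Real.pi * ξ : ℂ) * Complex.conj_mul' (diagonalizer θ (ψ : L2) ξ)

end SpectralMeasure

/-! ### Rank-one expansion and trace integral of the Fourier transform cut off on both sides. -/

section LocalTrace

open Filter Topology FourierTransform
open scoped ComplexConjugate ContDiff

/-- The L² transform agrees with the distributional one, and ∫ (𝓕 η) G = ∫ η (𝓕 G) identifies the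
latter with the Fourier integral when `G` is integrable. -/
lemma fourier_ae_eq {k : L2} {G : ℝ → ℂ} (hkG : k =ᵐ[volume] G) (hG : Integrable G) :
    (𝓕 k : L2) =ᵐ[volume] 𝓕 G := by
  have hc : Continuous (𝓕 G) := VectorFourier.fourierIntegral_continuous
    Real.continuous_fourierChar (by exact continuous_inner) hG
  refine ae_eq_of_integral_contDiff_smul_eq ((Lp.memLp (𝓕 k)).locallyIntegrable (by norm_num))
    hc.locallyIntegrable fun g hg hgc => ?_
  have hg₁ : HasCompactSupport (Complex.ofRealCLM ∘ g) := hgc.comp_left rfl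
  have hg₂ : ContDiff ℝ ∞ (Complex.ofRealCLM ∘ g) := by fun_prop
  set η : 𝓢(ℝ, ℂ) := hg₁.toSchwartzMap hg₂
  have hη : ∀ x, η x = g x := fun x => rfl
  have h1 := congrArg (fun T : 𝓢'(ℝ, ℂ) => T η) (Lp.fourier_toTemperedDistribution_eq k)
  simp only [TemperedDistribution.fourier_apply, Lp.toTemperedDistribution_apply] at h1
  have h2 : ∫ x, (𝓕 η) x • k x = ∫ x, (𝓕 η) x • G x :=
    integral_congr_ae (by filter_upwards [hkG] with x hx; rw [hx])
  have h3 : ∫ x, (𝓕 η) x • G x = ∫ x, η x • 𝓕 G x := by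
    have h := VectorFourier.integral_fourierIntegral_smul_eq_flip (L := innerₗ ℝ)
      Real.continuous_fourierChar continuous_inner (η.integrable (μ := volume)) hG
    rw [flip_innerₗ] at h
    exact h
  have h4 := h1.symm.trans (h2.trans h3)
  simpa only [hη, Complex.real_smul, smul_eq_mul] using h4

/-- The coefficients of `e^{-2πi t} = ∑ cₙ tⁿ`. -/
def fourierCoef (n : ℕ) : ℂ := (-2 * Real.pi * Complex.I) ^ n / (n.factorial : ℂ)

lemma norm_fourierCoef (n : ℕ) : ‖fourierCoef n‖ = (2 * Real.pi) ^ n / n.factorial := by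
  simp [fourierCoef, abs_of_pos Real.pi_pos]

lemma hasSum_fourierCoef (t : ℝ) :
    HasSum (fun n => fourierCoef n * (t : ℂ) ^ n) (Complex.exp (-2 * Real.pi * Complex.I * t)) := by
  have h := NormedSpace.expSeries_div_hasSum_exp (-2 * Real.pi * Complex.I * t : ℂ)
  rw [← Complex.exp_eq_exp_ℂ] at h
  refine h.congr_fun fun n => ?_
  rw [fourierCoef, mul_pow]
  ring

lemma summable_norm_fourierCoef (t : ℝ) : Summable fun n => ‖fourierCoef n‖ * t ^ n := by
  refine (Real.summable_pow_div_factorial (2 * Real.pi * t)).congr fun n => ?_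
  rw [norm_fourierCoef, mul_pow]
  ring

lemma volume_lt_top_of_subset_Icc {S : Set ℝ} {R : ℝ} (hR : S ⊆ Set.Icc (-R) R) :
    volume S < ⊤ :=
  (measure_mono hR).trans_lt measure_Icc_lt_top

lemma memLp_indicator_pow {S : Set ℝ} (hS : MeasurableSet S) {R : ℝ} (hR : S ⊆ Set.Icc (-R) R)
    (n : ℕ) : MemLp (S.indicator fun x : ℝ => (x : ℂ) ^ n) 2 volume := by
  have : IsFiniteMeasure ((volume : Measure ℝ).restrict S) :=
    ⟨by rw [Measure.restrict_apply_univ]; exact volume_lt_top_of_subset_Icc hR⟩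
  rw [memLp_indicator_iff_restrict hS]
  refine MemLp.of_bound (by fun_prop) (R ^ n) (ae_restrict_of_forall_mem hS fun x hx => ?_)
  rw [norm_pow, Complex.norm_real]
  exact pow_le_pow_left₀ (abs_nonneg _) (abs_le.2 (hR hx)) n

/-- `xⁿ` on the bounded set `S`, as an element of `L²(ℝ)`. -/
def truncMonomial {S : Set ℝ} (hS : MeasurableSet S) {R : ℝ} (hR : S ⊆ Set.Icc (-R) R) (n : ℕ) :
    L2 :=
  (memLp_indicator_pow hS hR n).toLp _

lemma coeFn_truncMonomial {S : Set ℝ} (hS : MeasurableSet S) {R : ℝ} (hR : S ⊆ Set.Icc (-R) R)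
    (n : ℕ) : truncMonomial hS hR n =ᵐ[volume] S.indicator fun x : ℝ => (x : ℂ) ^ n :=
  (memLp_indicator_pow hS hR n).coeFn_toLp

lemma norm_truncMonomial_le {S : Set ℝ} (hS : MeasurableSet S) {R : ℝ} (hR : S ⊆ Set.Icc (-R) R)
    (n : ℕ) : ‖truncMonomial hS hR n‖ ≤ R ^ n * ‖truncMonomial hS hR 0‖ := by
  refine Lp.norm_le_mul_norm_of_ae_le_mul ?_
  filter_upwards [coeFn_truncMonomial hS hR n, coeFn_truncMonomial hS hR 0] with x h1 h2
  rw [h1, h2]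
  by_cases hx : x ∈ S
  · simpa [hx] using pow_le_pow_left₀ (abs_nonneg _) (abs_le.2 (hR hx)) n
  · simp [hx]

lemma integrable_indicator_of_subset_Icc {J : Set ℝ} (hJ : MeasurableSet J) {M : ℝ}
    (hJM : J ⊆ Set.Icc (-M) M) {f : ℝ → ℂ} (hf : MemLp f 2 volume) :
    Integrable (J.indicator f) := by
  have : IsFiniteMeasure ((volume : Measure ℝ).restrict J) :=
    ⟨by rw [Measure.restrict_apply_univ]; exact volume_lt_top_of_subset_Icc hJM⟩
  rw [integrable_indicator_iff hJ]
  exact (hf.restrict J).integrable one_le_two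

section Expansion

variable {I J : Set ℝ} (hI : MeasurableSet I) (hJ : MeasurableSet J) {R M : ℝ}
  (hIR : I ⊆ Set.Icc (-R) R) (hJM : J ⊆ Set.Icc (-M) M)

/-- Termwise integration of the exponential series: on the bounded set `J` the factor uⁿ grows at
most like Mⁿ, against the factorial decay of `fourierCoef`. -/
lemma hasSum_fourier_indicator (g : L2) (ξ : ℝ) :
    HasSum (fun n => ⟪truncMonomial hJ hJM n, g⟫_ℂ * (fourierCoef n * (ξ : ℂ) ^ n))
      (𝓕 (J.indicator g) ξ) := by
  set G : ℝ → ℂ := J.indicator g with hGdef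
  have hG : Integrable G := integrable_indicator_of_subset_Icc hJ hJM (Lp.memLp g)
  set F : ℕ → ℝ → ℂ := fun n u => (fourierCoef n * (ξ : ℂ) ^ n) * ((u : ℂ) ^ n * G u)
  have hb : ∀ (n : ℕ) (u : ℝ), ‖(u : ℂ) ^ n * G u‖ ≤ M ^ n * ‖G u‖ := fun n u => by
    by_cases hu : u ∈ J
    · rw [norm_mul, norm_pow, Complex.norm_real]
      gcongr
      exact abs_le.2 (hJM hu)
    · simp [hGdef, hu]
  have hi : ∀ n, Integrable fun u : ℝ => (u : ℂ) ^ n * G u := fun n =>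
    (hG.norm.const_mul (M ^ n)).mono'
      ((by fun_prop : Continuous fun u : ℝ => (u : ℂ) ^ n).aestronglyMeasurable.mul hG.1)
      (.of_forall (hb n))
  have hs : Summable fun n => ∫ u, ‖F n u‖ := by
    refine ((summable_norm_fourierCoef (|ξ| * M)).mul_right (∫ u, ‖G u‖)).of_nonneg_of_le
      (fun n => integral_nonneg fun _ => norm_nonneg _) fun n => ?_
    calc ∫ u, ‖F n u‖ = ‖fourierCoef n‖ * |ξ| ^ n * ∫ u : ℝ, ‖(u : ℂ) ^ n * G u‖ := by
          rw [← integral_const_mul]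
          refine integral_congr_ae (.of_forall fun u => ?_)
          simp only [F]
          rw [norm_mul, norm_mul (fourierCoef n), norm_pow, Complex.norm_real, Real.norm_eq_abs]
      _ ≤ ‖fourierCoef n‖ * |ξ| ^ n * ∫ u, M ^ n * ‖G u‖ := by
          gcongr
          · exact (hi n).norm
          · exact hG.norm.const_mul _
          · exact fun u => hb n u
      _ = _ := by rw [integral_const_mul, mul_pow]; ring
  have h1 := hasSum_integral_of_summable_integral_norm (fun n => (hi n).const_mul _) hs
  have h2 : ∫ u, ∑' n, F n u = 𝓕 G ξ := by
    rw [Real.fourier_real_eq_integral_exp_smul]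
    refine integral_congr_ae (.of_forall fun u => ?_)
    have h := (hasSum_fourierCoef (u * ξ)).mul_right (G u)
    have e : ∀ n, F n u = fourierCoef n * ((u * ξ : ℝ) : ℂ) ^ n * G u := fun n => by
      simp only [F]; push_cast; ring
    simp only [e, h.tsum_eq, smul_eq_mul]
    congr 2
    push_cast; ring
  rw [← h2]
  refine h1.congr_fun fun n => ?_
  rw [integral_const_mul, inner_L2_eq_integral (coeFn_truncMonomial hJ hJM n) (ae_eq_refl g),
    mul_comm]
  congr 1
  refine integral_congr_ae (.of_forall fun u => ?_)
  by_cases hu : u ∈ J <;> simp [hGdef, hu]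

lemma summable_norm_truncMonomial : Summable fun n =>
    ‖truncMonomial hJ hJM n‖ * ‖fourierCoef n • truncMonomial hI hIR n‖ := by
  refine ((summable_norm_fourierCoef (M * R)).mul_right
    (‖truncMonomial hJ hJM 0‖ * ‖truncMonomial hI hIR 0‖)).of_nonneg_of_le
    (fun n => by positivity) fun n => ?_
  have h1 := norm_truncMonomial_le hJ hJM n
  have h2 := norm_truncMonomial_le hI hIR n
  rw [norm_smul]
  calc ‖truncMonomial hJ hJM n‖ * (‖fourierCoef n‖ * ‖truncMonomial hI hIR n‖)
      ≤ (M ^ n * ‖truncMonomial hJ hJM 0‖) *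
        (‖fourierCoef n‖ * (R ^ n * ‖truncMonomial hI hIR 0‖)) := by
        gcongr
        exact (norm_nonneg _).trans h1
    _ = _ := by rw [mul_pow]; ring

/-- The kernel e^{-2πiuξ} on `J × I` is the sum of the rank-one kernels cₙ uⁿ ξⁿ. -/
lemma hasSum_cutoff (g : L2) :
    HasSum (fun n => ⟪truncMonomial hJ hJM n, g⟫_ℂ • (fourierCoef n • truncMonomial hI hIR n))
      (restrictionProj I hI (𝓕 (restrictionProj J hJ g))) := by
  have hs : Summable fun n =>
      ⟪truncMonomial hJ hJM n, g⟫_ℂ • (fourierCoef n • truncMonomial hI hIR n) := by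
    refine Summable.of_norm (((summable_norm_truncMonomial hI hJ hIR hJM).mul_right
      ‖g‖).of_nonneg_of_le (fun n => norm_nonneg _) fun n => ?_)
    rw [norm_smul, mul_right_comm]
    gcongr
    exact norm_inner_le_norm _ _
  obtain ⟨s, hs⟩ := hs
  convert hs
  -- The series converges in L²; a subsequence of its partial sums converges almost everywhere, and
  -- there its limit is the pointwise expansion.
  obtain ⟨ns, hns, hlim⟩ :=
    (tendstoInMeasure_of_tendsto_Lp hs.tendsto_sum_nat).exists_seq_tendsto_ae
  have hterm : ∀ᵐ ξ : ℝ, ∀ n, (∑ i ∈ Finset.range n, ⟪truncMonomial hJ hJM i, g⟫_ℂ •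
      (fourierCoef i • truncMonomial hI hIR i) : L2) ξ = ∑ i ∈ Finset.range n,
      I.indicator (fun ξ : ℝ => ⟪truncMonomial hJ hJM i, g⟫_ℂ *
        (fourierCoef i * (ξ : ℂ) ^ i)) ξ := by
    rw [ae_all_iff]
    intro n
    have h1 : ∀ᵐ ξ : ℝ, ∀ i, (⟪truncMonomial hJ hJM i, g⟫_ℂ •
        (fourierCoef i • truncMonomial hI hIR i) : L2) ξ =
        I.indicator (fun ξ : ℝ => ⟪truncMonomial hJ hJM i, g⟫_ℂ *
        (fourierCoef i * (ξ : ℂ) ^ i)) ξ := by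
      rw [ae_all_iff]
      intro i
      filter_upwards [Lp.coeFn_smul ⟪truncMonomial hJ hJM i, g⟫_ℂ
        (fourierCoef i • truncMonomial hI hIR i), Lp.coeFn_smul (fourierCoef i)
        (truncMonomial hI hIR i), coeFn_truncMonomial hI hIR i] with ξ e1 e2 e3
      rw [e1, Pi.smul_apply, e2, Pi.smul_apply, e3]
      by_cases hξ : ξ ∈ I <;> simp [hξ]
    filter_upwards [h1, Lp.coeFn_finsetSum (Finset.range n) fun i =>
      ⟪truncMonomial hJ hJM i, g⟫_ℂ • (fourierCoef i • truncMonomial hI hIR i)] with ξ h1 h2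
    rw [h2, Finset.sum_apply]
    exact Finset.sum_congr rfl fun i _ => h1 i
  refine Lp.ext ?_
  filter_upwards [hlim, hterm, coeFn_restrictionProj hI (𝓕 (restrictionProj J hJ g)),
    fourier_ae_eq (coeFn_restrictionProj hJ g)
      (integrable_indicator_of_subset_Icc hJ hJM (Lp.memLp g))] with ξ h1 h2 h3 h4
  refine tendsto_nhds_unique ?_ h1
  simp only [h2]
  rw [h3]
  by_cases hξ : ξ ∈ I
  · simp only [Set.indicator_of_mem hξ]
    rw [h4]
    exact (hasSum_fourier_indicator hJ hJM g ξ).tendsto_sum_nat.comp hns.tendsto_atTop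
  · simp [Set.indicator_of_notMem hξ]

/-- Each term is the integral over `I × J` of the conjugate of e^{-2πiuξ} times the n-th term of its
own series. Resummed, the integrand is |e^{-2πiuξ}|² = 1. -/
lemma tsum_inner_truncMonomial :
    ∑' n, ⟪(𝓕 (truncMonomial hJ hJM n) : L2), fourierCoef n • truncMonomial hI hIR n⟫_ℂ =
      ((volume.real I * volume.real J : ℝ) : ℂ) := by
  have fI : IsFiniteMeasure ((volume : Measure ℝ).restrict I) :=
    ⟨by rw [Measure.restrict_apply_univ]; exact volume_lt_top_of_subset_Icc hIR⟩
  have fJ : IsFiniteMeasure ((volume : Measure ℝ).restrict J) :=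
    ⟨by rw [Measure.restrict_apply_univ]; exact volume_lt_top_of_subset_Icc hJM⟩
  set ν := ((volume : Measure ℝ).restrict I).prod ((volume : Measure ℝ).restrict J) with hν
  set F : ℕ → ℝ × ℝ → ℂ := fun n z =>
    conj (Complex.exp (((-2 * Real.pi * z.2 * z.1 : ℝ) : ℂ) * Complex.I)) *
      (fourierCoef n * ((z.2 * z.1 : ℝ) : ℂ) ^ n)
  have hexp : ∀ z : ℝ × ℝ,
      ‖Complex.exp (((-2 * Real.pi * z.2 * z.1 : ℝ) : ℂ) * Complex.I)‖ = 1 :=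
    fun z => Complex.norm_exp_ofReal_mul_I _
  have hmem : ∀ᵐ z ∂ν, z ∈ I ×ˢ J := by
    rw [hν, Measure.prod_restrict]
    exact ae_restrict_mem (hI.prod hJ)
  have hb : ∀ n, ∀ᵐ z ∂ν, ‖F n z‖ ≤ ‖fourierCoef n‖ * (M * R) ^ n := fun n => by
    filter_upwards [hmem] with z hz
    have h1 : |z.1| ≤ R := abs_le.2 (hIR hz.1)
    have h2 : |z.2| ≤ M := abs_le.2 (hJM hz.2)
    simp only [F]
    rw [norm_mul, RCLike.norm_conj, hexp, one_mul, norm_mul, norm_pow, Complex.norm_real,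
      Real.norm_eq_abs, abs_mul]
    gcongr
    exact (abs_nonneg _).trans h2
  have hFc : ∀ n, Continuous (F n) := fun n => by
    have : Continuous fun z : ℂ => conj z := Complex.continuous_conj
    simp only [F]
    fun_prop
  have hFi : ∀ n, Integrable (F n) ν := fun n =>
    Integrable.of_bound (hFc n).aestronglyMeasurable _ (hb n)
  have hs : Summable fun n => ∫ z, ‖F n z‖ ∂ν := by
    refine ((summable_norm_fourierCoef (M * R)).mul_right (ν.real Set.univ)).of_nonneg_of_le
      (fun n => integral_nonneg fun _ => norm_nonneg _) fun n => ?_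
    have h := integral_mono_ae (hFi n).norm (integrable_const (‖fourierCoef n‖ * (M * R) ^ n)) (hb n)
    rwa [integral_const, smul_eq_mul, mul_comm] at h
  have h1 := hasSum_integral_of_summable_integral_norm hFi hs
  have h2 : ∫ z, ∑' n, F n z ∂ν = ((volume.real I * volume.real J : ℝ) : ℂ) := by
    have e : ∀ z, ∑' n, F n z = 1 := fun z => by
      have h := (hasSum_fourierCoef (z.2 * z.1)).mul_left
        (conj (Complex.exp (((-2 * Real.pi * z.2 * z.1 : ℝ) : ℂ) * Complex.I)))
      have e2 : (-2 * Real.pi * Complex.I * ((z.2 * z.1 : ℝ) : ℂ) : ℂ) =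
          ((-2 * Real.pi * z.2 * z.1 : ℝ) : ℂ) * Complex.I := by push_cast; ring
      rw [h.tsum_eq, e2, Complex.conj_mul', hexp]
      simp
    simp only [e, integral_const]
    rw [hν, ← Set.univ_prod_univ, measureReal_prod_prod, measureReal_restrict_apply_univ,
      measureReal_restrict_apply_univ]
    simp
  rw [← h2, ← h1.tsum_eq]
  refine tsum_congr fun n => ?_
  have hsm : (fourierCoef n • truncMonomial hI hIR n : L2) =ᵐ[volume]
      I.indicator fun ξ : ℝ => fourierCoef n * (ξ : ℂ) ^ n := by
    filter_upwards [Lp.coeFn_smul (fourierCoef n) (truncMonomial hI hIR n),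
      coeFn_truncMonomial hI hIR n] with ξ e1 e2
    rw [e1, Pi.smul_apply, e2]
    by_cases hξ : ξ ∈ I <;> simp [hξ]
  have hint : Integrable (J.indicator fun u : ℝ => (u : ℂ) ^ n) := by
    have h := integrable_indicator_of_subset_Icc hJ hJM (memLp_indicator_pow hJ hJM n)
    rwa [Set.indicator_indicator, Set.inter_self] at h
  rw [inner_L2_eq_integral (fourier_ae_eq (coeFn_truncMonomial hJ hJM n) hint) hsm,
    integral_prod _ (hFi n), ← integral_indicator hI]
  refine integral_congr_ae (.of_forall fun ξ => ?_)
  by_cases hξ : ξ ∈ I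
  · simp only [Set.indicator_of_mem hξ, F]
    rw [Real.fourier_real_eq_integral_exp_smul, ← integral_conj, ← integral_mul_const,
      ← integral_indicator hJ]
    refine integral_congr_ae (.of_forall fun u => ?_)
    by_cases hu : u ∈ J
    · simp only [Set.indicator_of_mem hu, smul_eq_mul, map_mul, map_pow, Complex.conj_ofReal]
      push_cast
      ring
    · simp [hu]
  · simp [hξ]

end Expansion

end LocalTrace

/-! ### The trace of P Q_Λ and the density of states. -/

section LocalIDOS

open FourierTransform

lemma kelvin_restrictionProj (θ : ℝ) {Λ : Set ℝ} (hΛ : MeasurableSet Λ) (f : L2) :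
    kelvin θ (restrictionProj Λ hΛ f) =
      restrictionProj (Inv.inv ⁻¹' Λ) (hΛ.preimage measurable_inv) (kelvin θ f) := by
  refine Lp.ext ?_
  filter_upwards [coeFn_kelvin θ (restrictionProj Λ hΛ f),
    kelvinFun_congr θ (coeFn_restrictionProj hΛ f),
    coeFn_restrictionProj (hΛ.preimage measurable_inv) (kelvin θ f), coeFn_kelvin θ f]
    with u h1 h2 h3 h4
  rw [h1, h2, h3, kelvinFun]
  by_cases hu : u⁻¹ ∈ Λ
  · rw [Set.indicator_of_mem hu, Set.indicator_of_mem (s := Inv.inv ⁻¹' Λ) hu, h4, kelvinFun]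
  · rw [Set.indicator_of_notMem hu, Set.indicator_of_notMem (s := Inv.inv ⁻¹' Λ) hu, mul_zero]

section

variable (θ : ℝ) {B Λ : Set ℝ} (hB : MeasurableSet B) (hΛ : MeasurableSet Λ) {R M : ℝ}
  (hR : momentumSet B ⊆ Set.Icc (-R) R) (hM : Inv.inv ⁻¹' Λ ⊆ Set.Icc (-M) M)

/-- Inversion carries the cutoff to Λ into the cutoff to its image under x ↦ 1/x, and `diagonalizer`
is `kelvin` followed by 𝓕; the product is thus the cutoff Fourier transform between two unitaries,
which transport its expansion. -/
lemma hasSum_momentumProj_restrictionProj (f : L2) :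
    HasSum (fun n => ⟪(kelvin θ).symm (truncMonomial (hΛ.preimage measurable_inv) hM n), f⟫_ℂ •
      (diagonalizer θ).symm
        (fourierCoef n • truncMonomial (measurableSet_momentumSet hB) hR n))
      ((momentumProj θ B hB ∘L restrictionProj Λ hΛ) f) := by
  have h := (hasSum_cutoff (measurableSet_momentumSet hB) (hΛ.preimage measurable_inv) hR hM
    (kelvin θ f)).mapL (diagonalizer θ).symm.toContinuousLinearEquiv.toContinuousLinearMap
  rw [← kelvin_restrictionProj] at h
  refine h.congr_fun fun n => ?_
  rw [← (kelvin θ).inner_map_map _ f, LinearIsometryEquiv.apply_symm_apply]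
  exact ((diagonalizer θ).symm.map_smul _ _).symm

lemma summable_norm_momentumProj_restrictionProj : Summable fun n =>
    ‖(kelvin θ).symm (truncMonomial (hΛ.preimage measurable_inv) hM n)‖ *
      ‖(diagonalizer θ).symm
        (fourierCoef n • truncMonomial (measurableSet_momentumSet hB) hR n)‖ := by
  simp only [LinearIsometryEquiv.norm_map]
  exact summable_norm_truncMonomial _ _ _ _

end

theorem isTraceClass_momentumProj_restrictionProj (θ : ℝ) {B Λ : Set ℝ}
    (hB : MeasurableSet B) (hΛ : MeasurableSet Λ) {R M : ℝ}
    (hR : momentumSet B ⊆ Set.Icc (-R) R) (hM : Inv.inv ⁻¹' Λ ⊆ Set.Icc (-M) M) :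
    IsTraceClass (momentumProj θ B hB ∘L restrictionProj Λ hΛ) :=
  isTraceClass_of_nuclear (summable_norm_momentumProj_restrictionProj θ hB hΛ hR hM)
    (hasSum_momentumProj_restrictionProj θ hB hΛ hR hM)

theorem trace_momentumProj_restrictionProj (θ : ℝ) {B Λ : Set ℝ}
    (hB : MeasurableSet B) (hΛ : MeasurableSet Λ) {R M : ℝ}
    (hR : momentumSet B ⊆ Set.Icc (-R) R) (hM : Inv.inv ⁻¹' Λ ⊆ Set.Icc (-M) M) :
    trace (momentumProj θ B hB ∘L restrictionProj Λ hΛ) =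
      ((volume.real (momentumSet B) * volume.real (Inv.inv ⁻¹' Λ) : ℝ) : ℂ) := by
  rw [trace_eq_of_nuclear (summable_norm_momentumProj_restrictionProj θ hB hΛ hR hM)
    (hasSum_momentumProj_restrictionProj θ hB hΛ hR hM),
    ← tsum_inner_truncMonomial (measurableSet_momentumSet hB) (hΛ.preimage measurable_inv) hR hM]
  refine tsum_congr fun n => ?_
  -- Of `diagonalizer` applied to `(kelvin θ).symm` only the Fourier transform remains.
  rw [← (diagonalizer θ).inner_map_map, LinearIsometryEquiv.apply_symm_apply]
  congr 1
  exact congrArg (Lp.fourierTransformₗᵢ ℝ ℂ) ((kelvin θ).apply_symm_apply _)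

lemma momentumSet_Icc (c d : ℝ) :
    momentumSet (Set.Icc c d) = Set.Icc (c / (2 * Real.pi)) (d / (2 * Real.pi)) := by
  ext ξ
  have := Real.two_pi_pos
  rw [momentumSet, Set.mem_preimage, Set.mem_Icc, Set.mem_Icc, div_le_iff₀ this,
    le_div_iff₀ this, mul_comm ξ]

lemma inv_preimage_Icc {a b : ℝ} (hpos : 0 < a * b) :
    Inv.inv ⁻¹' Set.Icc a b = Set.Icc b⁻¹ a⁻¹ := by
  ext u
  rw [Set.mem_preimage, Set.mem_Icc, Set.mem_Icc]
  rcases pos_and_pos_or_neg_and_neg_of_mul_pos hpos with ⟨ha, hb⟩ | ⟨ha, hb⟩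
  · constructor
    · rintro ⟨h1, h2⟩
      have hu : 0 < u := inv_pos.1 (ha.trans_le h1)
      exact ⟨(inv_le_comm₀ hu hb).1 h2, (le_inv_comm₀ ha hu).1 h1⟩
    · rintro ⟨h1, h2⟩
      have hu : 0 < u := (inv_pos.2 hb).trans_le h1
      exact ⟨(le_inv_comm₀ ha hu).2 h2, (inv_le_comm₀ hu hb).2 h1⟩
  · constructor
    · rintro ⟨h1, h2⟩
      have hu : u < 0 := inv_lt_zero.1 (h2.trans_lt hb)
      exact ⟨(inv_le_of_neg hu hb).1 h2, (le_inv_of_neg ha hu).1 h1⟩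
    · rintro ⟨h1, h2⟩
      have hu : u < 0 := h2.trans_lt (inv_lt_zero.2 ha)
      exact ⟨(le_inv_of_neg ha hu).2 h2, (inv_le_of_neg hu hb).2 h1⟩

lemma exists_Icc_subset_Icc_neg (c d : ℝ) : ∃ R, Set.Icc c d ⊆ Set.Icc (-R) R :=
  ⟨max (-c) d, Set.Icc_subset_Icc (by linarith [le_max_left (-c) d]) (le_max_right _ _)⟩

/-- Only the length of the spectral interval enters the trace. At `ε = 0` the interval degenerates
to `{0}`, of length `|ε| = 0`. -/
lemma exists_thermalProj_eq (θ ε : ℝ) : ∃ c d : ℝ, d - c = |ε| ∧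
    thermalProj θ ε = momentumProj θ (Set.Icc c d) measurableSet_Icc := by
  rcases lt_or_ge 0 ε with h | h
  · refine ⟨0, ε, by rw [sub_zero, abs_of_pos h], ?_⟩
    rw [thermalProj, if_pos h, spectralProjection_eq (momentumMeasure_represents θ)
      measurableSet_Icc, momentumMeasure_proj]
  · refine ⟨ε, 0, by rw [zero_sub, abs_of_nonpos h], ?_⟩
    rw [thermalProj, if_neg h.not_gt, spectralProjection_eq (momentumMeasure_represents θ)
      measurableSet_Icc, momentumMeasure_proj]

theorem isTraceClass_and_trace_eq (θ a b : ℝ) (hab : a < b) (hpos : 0 < a * b) (ε : ℝ) :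
    IsTraceClass (thermalProj θ ε ∘L restrictionProj (Set.Icc a b) measurableSet_Icc) ∧
    trace (thermalProj θ ε ∘L restrictionProj (Set.Icc a b) measurableSet_Icc) =
      ((|ε| / (2 * Real.pi) * (a⁻¹ - b⁻¹) : ℝ) : ℂ) := by
  obtain ⟨c, d, hcd, h⟩ := exists_thermalProj_eq θ ε
  obtain ⟨R, hR⟩ := exists_Icc_subset_Icc_neg (c / (2 * Real.pi)) (d / (2 * Real.pi))
  obtain ⟨M, hM⟩ := exists_Icc_subset_Icc_neg b⁻¹ a⁻¹
  rw [← momentumSet_Icc] at hR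
  rw [← inv_preimage_Icc hpos] at hM
  have hle : b⁻¹ ≤ a⁻¹ := by
    rcases pos_and_pos_or_neg_and_neg_of_mul_pos hpos with ⟨ha, hb⟩ | ⟨ha, hb⟩
    · exact (inv_le_inv₀ hb ha).2 hab.le
    · exact (inv_le_inv_of_neg hb ha).2 hab.le
  have hle2 : c / (2 * Real.pi) ≤ d / (2 * Real.pi) := by
    have : c ≤ d := by linarith [abs_nonneg ε]
    have := Real.two_pi_pos
    gcongr
  rw [h]
  refine ⟨isTraceClass_momentumProj_restrictionProj θ measurableSet_Icc measurableSet_Icc hR hM, ?_⟩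
  rw [trace_momentumProj_restrictionProj θ measurableSet_Icc measurableSet_Icc hR hM,
    inv_preimage_Icc hpos, momentumSet_Icc, Real.volume_real_Icc_of_le hle,
    Real.volume_real_Icc_of_le hle2, ← sub_div, hcd]

end LocalIDOS

end ThermalDOS

end

theorem lemma2p8 (θ a b : ℝ) (hab : a < b) (hpos : 0 < a * b) (ε : ℝ) :
    ThermalDOS.IsTraceClass
      (ThermalDOS.thermalProj θ ε ∘L
        ThermalDOS.restrictionProj (Set.Icc a b) measurableSet_Icc) ∧
    ThermalDOS.localIDOS θ a b ε = ((1 / (a * b) * (ε / (2 * Real.pi)) : ℝ) : ℂ) := by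
  obtain ⟨h1, h2⟩ := ThermalDOS.isTraceClass_and_trace_eq θ a b hab hpos ε
  refine ⟨h1, ?_⟩
  have ha : a ≠ 0 := fun h => by simp [h] at hpos
  have hb : b ≠ 0 := fun h => by simp [h] at hpos
  have hba : b - a ≠ 0 := sub_ne_zero.2 hab.ne'
  have hpi : Real.pi ≠ 0 := Real.pi_ne_zero
  rw [ThermalDOS.localIDOS, h2, Real.volume_Icc, ENNReal.toReal_ofReal (sub_nonneg.2 hab.le)]
  norm_cast
  have he : (SignType.sign ε : ℝ) * |ε| = ε := sign_mul_abs ε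
  -- The prefactor sgn(ε) turns |ε| into ε, and (1/a - 1/b)/(b - a) = 1/(ab).
  calc (SignType.sign ε : ℝ) / (b - a) * (|ε| / (2 * Real.pi) * (a⁻¹ - b⁻¹))
      = ((SignType.sign ε : ℝ) * |ε|) * (1 / (b - a) / (2 * Real.pi) * (a⁻¹ - b⁻¹)) := by ring
    _ = 1 / (a * b) * (ε / (2 * Real.pi)) := by
      rw [he]
      field_simp
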